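/- **Setting.** Let $V$ be a set of program variables, each variable $v$ having a nonempty type $T_v$. A memory assigns to each $v\in V$ an element of $T_v$; let $\mathcal M$ be the set of memories and $\mathcal H=\ell^2(\mathcal M)$. Let $x,y\in V$ be distinct variables of types $\mathbb Z$ and $\{0,1\}$. A *mixed memory* is a positive trace-class operator (not necessarily of trace one). For a set $X$ of variables, an operator on $\ell^2$ of the assignments to $X$ is identified with its tensor product with the identity on the remaining variables. Programs are interpreted as maps on mixed memories over $\mathcal H$: $[\![\mathbf{skip}]\!](\rho)=\rho$; $[\![c;d]\!]=[\![d]\!]\circ[\![c]\!]$; $[\![\mathbf{apply}\ U\ \mathbf{to}\ X]\!](\rho)=U\rho U^\dagger$ for an isometry $U$; $[\![\mathbf{init}\ X\ \psi]\!](\rho)=\operatorname{tr}_X\rho\otimes|\psi\rangle\langle\psi|$ for a unit vector $\psi$; and for a binary measurement $M$ on $X$ with Kraus operators $M_{\mathrm t},M_{\mathrm f}$ ($M_{\mathrm t}^\dagger M_{\mathrm t}+M_{\mathrm f}^\dagger M_{\mathrm f}=\mathrm{id}$) and $\downarrow_s(\rho)=M_s\rho M_s^\dagger$, $$[\![\mathbf{if}\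 M[X]\ \mathbf{then}\ c\ \mathbf{else}\ d]\!](\rho)=[\![c]\!](\downarrow_{\mathrm t}\rho)+[\![d]\!](\downarrow_{\mathrm f}\rho),\qquad [\![\mathbf{while}\ M[X]\ \mathbf{do}\ c]\!](\rho)=\sum_{k\ge 0}\downarrow_{\mathrm f}\big(([\![c]\!]\circ\downarrow_{\mathrm t})^k(\rho)\big).$$ A mixed memory $\rho$ on $\mathcal H\otimes\mathcal H$ is *separable* if $\rho=\sum_i\sigma_i\otimes\tau_i$ with mixed memories $\sigma_i,\tau_i$ on $\mathcal H$. For positive bounded operators $A,B$ on $\mathcal H\otimes\mathcal H$, the judgment $\{A\}\,c\sim d\,\{B\}$ means: for every separable $\rho$ there is a separable $\rho'$ with $\operatorname{tr}_2\rho'=[\![c]\!](\operatorname{tr}_2\rho)$, $\operatorname{tr}_1\rho'=[\![d]\!](\operatorname{tr}_1\rho)$ and $\operatorname{tr}A\rho\le\operatorname{tr}B\rho'$. Let $\mathrm{EQUAL}_{y_1y_2}$ be the projector onto the vectors of $\mathcal H\otimes\mathcal H$ that are invariant under swapping the two copies $y_1,y_2$ of $y$. **Programs.** For $n\ge1$ let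 $R=\begin{pmatrix}\cos\frac{\pi}{2n}&-\sin\frac{\pi}{2n}\\ \sin\frac{\pi}{2n}&\cos\frac{\pi}{2n}\end{pmatrix}$, $\varphi_0=|0\rangle$, $\varphi_{i+1}=R\varphi_i$ for $i\ge 0$, $\mathrm{incr}|i\rangle=|i+1\rangle$ on $\ell^2(\mathbb Z)$, let $P_{<n}$ be the projector onto the closed span of $\{|i\rangle: i<n\}$ in $\ell^2(\mathbb Z)$, and $P_\varphi=\sum_{i\ge0}|i\otimes\varphi_i\rangle\langle i\otimes\varphi_i|$; a projector $P$ also denotes the binary measurement with Kraus operators $P,\mathrm{id}-P$. Let $$c_n:=\mathbf{init}\ x\ |0\rangle;\ \mathbf{init}\ y\ |0\rangle;\ \mathbf{while}\ P_{<n}[x]\ \mathbf{do}\ (\mathbf{apply}\ \mathrm{incr}\ \mathbf{to}\ x;\ \mathbf{apply}\ R\ \mathbf{to}\ y),$$ $$d_n:=\mathbf{init}\ x\ |0\rangle;\ \mathbf{init}\ y\ |0\rangle;\ \mathbf{while}\ P_{<n}[x]\ \mathbf{do}\ (\mathbf{apply}\ \mathrm{incr}\ \mathbf{to}\ x;\ \mathbf{if}\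 P_\varphi[xy]\ \mathbf{then}\ \mathbf{skip}\ \mathbf{else}\ \mathbf{skip}),$$ and $\varepsilon_n:=\left(\cos\frac{\pi}{2n}\right)^2$. **Claim.** (1) For every $n\ge1$, the judgment $\{\varepsilon_n^{\,n}\cdot\mathrm{id}\}\;c_n\sim d_n\;\{\mathrm{EQUAL}_{y_1y_2}\}$ holds. (2) $\varepsilon_n^{\,n}\to1$ as $n\to\infty$. (3) The final states of $y$ agree asymptotically: for all mixed memories $\rho_1,\rho_2$ on $\mathcal H$ of trace one, the states of $y$ in $[\![c_n]\!](\rho_1)$ and $[\![d_n]\!](\rho_2)$ (all other variables traced out) satisfy $$\big\|\operatorname{tr}_{V\setminus\{y\}}[\![c_n]\!](\rho_1)-\operatorname{tr}_{V\setminus\{y\}}[\![d_n]\!](\rho_2)\big\|\longrightarrow0\qquad(n\to\infty).$$ -/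

import Mathlib

noncomputable section

namespace QRHL

open scoped InnerProductSpace ENNReal

/-! ## The Hilbert spaces `ℓ²(I)` and bounded operators on them -/

/-- The Hilbert space with orthonormal basis indexed by an arbitrary set `I`. -/
abbrev Ell2 (I : Type*) : Type _ := lp (fun _ : I => ℂ) 2

/-- Bounded linear operators on `ℓ²(I)`. -/
abbrev Op (I : Type*) : Type _ := Ell2 I →L[ℂ] Ell2 I

open Classical in
/-- The basis vector `|i⟩`. -/
def ket {I : Type*} (i : I) : Ell2 I := lp.single 2 i (1 : ℂ)

theorem summable_sq {I : Type*} (ψ : Ell2 I) : Summable fun i => ‖ψ i‖ ^ 2 := by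
  have h := (lp.memℓp ψ).summable (by norm_num)
  simpa using h

theorem norm_sq_eq {I : Type*} (ψ : Ell2 I) : ‖ψ‖ ^ 2 = ∑' i, ‖ψ i‖ ^ 2 := by
  have h := lp.norm_rpow_eq_tsum (p := 2) (by norm_num) ψ
  simpa using h

theorem memlp_of_summable {I : Type*} {f : I → ℂ} (h : Summable fun i => ‖f i‖ ^ 2) :
    Memℓp (E := fun _ : I => ℂ) f 2 := by
  apply memℓp_gen
  simpa using h

/-- Precomposition `ψ ↦ ψ ∘ f` with an injective map of index sets. -/
def comap {I J : Type*} (f : I → J) (hf : Function.Injective f) : Ell2 J →L[ℂ] Ell2 I :=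
  LinearMap.mkContinuous
    { toFun := fun ψ => ⟨fun i => ψ (f i), memlp_of_summable ((summable_sq ψ).comp_injective hf)⟩
      map_add' := fun _ _ => rfl
      map_smul' := fun _ _ => rfl } 1 (fun ψ => by
    rw [one_mul]
    refine abs_le_of_sq_le_sq' ?_ (norm_nonneg _) |>.2
    rw [norm_sq_eq, norm_sq_eq]
    exact ((summable_sq ψ).comp_injective hf).tsum_le_tsum_of_inj f hf
      (fun _ _ => sq_nonneg _) (fun _ => le_rfl) (summable_sq ψ))

/-- The natural isomorphism `ℓ²(I) ≅ ℓ²(J)` given by a bijection `I ≃ J`; it maps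
`|i⟩` to `|e i⟩`. -/
def relabel {I J : Type*} (e : I ≃ J) : Ell2 I ≃ₗᵢ[ℂ] Ell2 J where
  toFun := comap e.symm e.symm.injective
  invFun := comap e e.injective
  map_add' := map_add _
  map_smul' := map_smul _
  left_inv ψ := by
    apply lp.ext
    funext i
    exact congrArg ψ (e.symm_apply_apply i)
  right_inv ψ := by
    apply lp.ext
    funext i
    exact congrArg ψ (e.apply_symm_apply i)
  norm_map' ψ := by
    refine (sq_eq_sq₀ (norm_nonneg _) (norm_nonneg _)).1 ?_
    rw [norm_sq_eq, norm_sq_eq]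
    exact e.symm.tsum_eq (fun i => ‖ψ i‖ ^ 2)

/-- Transport of an operator along `ℓ²(I) ≅ ℓ²(J)`. -/
def relabelOp {I J : Type*} (e : I ≃ J) (A : Op I) : Op J :=
  (relabel e).toContinuousLinearEquiv.toContinuousLinearMap ∘L A ∘L
    (relabel e).symm.toContinuousLinearEquiv.toContinuousLinearMap

/-- Transport of an isometry along `ℓ²(I) ≅ ℓ²(J)`. -/
def relabelIso {I J : Type*} (e : I ≃ J) (U : Ell2 I →ₗᵢ[ℂ] Ell2 I) : Ell2 J →ₗᵢ[ℂ] Ell2 J :=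
  (relabel e).toLinearIsometry.comp (U.comp (relabel e).symm.toLinearIsometry)

/-! ## Tensor products -/

/-- The vector `φ ⊗ χ`. -/
def tensorVec {I J : Type*} (φ : Ell2 I) (χ : Ell2 J) : Ell2 (I × J) :=
  ⟨fun p => φ p.1 * χ p.2, memlp_of_summable (by
    simp only [norm_mul, mul_pow]
    exact (summable_sq φ).mul_of_nonneg (summable_sq χ)
      (fun _ => sq_nonneg _) (fun _ => sq_nonneg _))⟩

/-- The operator `id ⊗ ⟨j| : ℓ²(I × J) → ℓ²(I)`, `(slice j ψ) i = ψ (i, j)`. Its adjoint is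
`id ⊗ |j⟩`, i.e. `φ ↦ φ ⊗ |j⟩`. -/
def slice {I J : Type*} (j : J) : Ell2 (I × J) →L[ℂ] Ell2 I :=
  comap (fun i => (i, j)) (fun _ _ h => (Prod.mk.inj h).1)

theorem summable_slice {I J : Type*} (ψ : Ell2 (I × J)) :
    Summable fun j : J => ‖(slice j : Ell2 (I × J) →L[ℂ] Ell2 I) ψ‖ ^ 2 := by
  have h : Summable fun p : J × I => ‖ψ (p.2, p.1)‖ ^ 2 :=
    (Equiv.prodComm J I).summable_iff.2 (summable_sq ψ)
  have h2 := h.prod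
  refine h2.congr fun j => ?_
  exact (norm_sq_eq ((slice j : Ell2 (I × J) →L[ℂ] Ell2 I) ψ)).symm

theorem norm_sq_eq_slice {I J : Type*} (ψ : Ell2 (I × J)) :
    ‖ψ‖ ^ 2 = ∑' j : J, ‖(slice j : Ell2 (I × J) →L[ℂ] Ell2 I) ψ‖ ^ 2 := by
  have h : Summable fun p : J × I => ‖ψ (p.2, p.1)‖ ^ 2 :=
    (Equiv.prodComm J I).summable_iff.2 (summable_sq ψ)
  rw [norm_sq_eq, ← (Equiv.prodComm J I).tsum_eq]
  refine (h.tsum_prod).trans ?_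
  exact tsum_congr fun j => (norm_sq_eq ((slice j : Ell2 (I × J) →L[ℂ] Ell2 I) ψ)).symm

theorem summable_amp {I J : Type*} (A : Op I) (ψ : Ell2 (I × J)) :
    Summable fun p : I × J => ‖A (slice p.2 ψ) p.1‖ ^ 2 := by
  rw [← (Equiv.prodComm J I).summable_iff]
  refine (summable_prod_of_nonneg (fun _ => sq_nonneg _)).2 ⟨fun j => ?_, ?_⟩
  · exact summable_sq (A (slice j ψ))
  · refine Summable.of_nonneg_of_le (fun j => tsum_nonneg fun _ => sq_nonneg _) (fun j => ?_)
      ((summable_slice ψ).mul_left (‖A‖ ^ 2))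
    refine (norm_sq_eq (A (slice j ψ))).symm.le.trans ?_
    rw [← mul_pow]
    exact pow_le_pow_left₀ (norm_nonneg _) (A.le_opNorm _) 2

/-- The operator `A ⊗ id` on `ℓ²(I × J)`: `A` is applied to each slice `ψ (·, j)`. -/
def ampLeft {I J : Type*} (A : Op I) : Op (I × J) :=
  LinearMap.mkContinuous
    { toFun := fun ψ => ⟨fun p => A (slice p.2 ψ) p.1, memlp_of_summable (summable_amp A ψ)⟩
      map_add' := fun ψ χ => by
        apply lp.ext
        funext p
        simp only [map_add, lp.coeFn_add, Pi.add_apply]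
      map_smul' := fun c ψ => by
        apply lp.ext
        funext p
        simp only [map_smul, lp.coeFn_smul, Pi.smul_apply, RingHom.id_apply] } ‖A‖ (fun ψ => by
    refine abs_le_of_sq_le_sq' ?_ (by positivity) |>.2
    rw [norm_sq_eq_slice, mul_pow, norm_sq_eq_slice ψ, ← tsum_mul_left]
    refine (summable_slice _).tsum_le_tsum (fun j => ?_) ((summable_slice ψ).mul_left _)
    rw [← mul_pow]
    exact pow_le_pow_left₀ (norm_nonneg _) (A.le_opNorm (slice j ψ)) 2)

/-- The operator `id ⊗ B` on `ℓ²(I × J)`. -/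
def ampRight {I J : Type*} (B : Op J) : Op (I × J) :=
  relabelOp (Equiv.prodComm J I) (ampLeft B)

/-- The operator `A ⊗ B = (A ⊗ id) (id ⊗ B)`. -/
def tensorOp {I J : Type*} (A : Op I) (B : Op J) : Op (I × J) :=
  ampLeft A ∘L ampRight B

/-! ## Mixed states

Infinite sums of operators below are taken in the operator norm. They are only ever applied to
families of positive trace-class operators whose traces are summable; for such families
the sum exists, and coincides with the sum in trace norm and with the supremum of
the finite partial sums in the Loewner order. -/

/-- The trace `∑ᵢ ⟨i|A|i⟩`. -/
def trace {I : Type*} (A : Op I) : ℂ := ∑' i : I, ⟪ket i, A (ket i)⟫_ℂ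

/-- Mixed states: positive trace-class operators (not necessarily normalized). -/
def IsMixed {I : Type*} (ρ : Op I) : Prop :=
  ρ.IsPositive ∧ Summable fun i : I => ⟪ket i, ρ (ket i)⟫_ℂ

/-- The partial trace over the second factor, `∑ⱼ (id ⊗ ⟨j|) ρ (id ⊗ |j⟩)`. -/
def traceSnd {I J : Type*} (ρ : Op (I × J)) : Op I :=
  ∑' j : J, slice j ∘L ρ ∘L (ContinuousLinearMap.adjoint (slice j : Ell2 (I × J) →L[ℂ] Ell2 I))

/-- The partial trace over the first factor. -/
def traceFst {I J : Type*} (ρ : Op (I × J)) : Op J :=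
  traceSnd (relabelOp (Equiv.prodComm I J) ρ)

/-- Separable mixed states: `ρ = ∑ᵢ σᵢ ⊗ τᵢ` with mixed states `σᵢ`, `τᵢ`. -/
def IsSeparable {I J : Type*} (ρ : Op (I × J)) : Prop :=
  IsMixed ρ ∧ ∃ (ι : Type) (σ : ι → Op I) (τ : ι → Op J),
    (∀ i, IsMixed (σ i)) ∧ (∀ i, IsMixed (τ i)) ∧ HasSum (fun i => tensorOp (σ i) (τ i)) ρ

/-- The operator `|ψ⟩⟨ψ|`. -/
def proj {I : Type*} (ψ : Ell2 I) : Op I := InnerProductSpace.rankOne ℂ ψ ψ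

/-- `A ρ A†`. -/
def conj {I : Type*} (A ρ : Op I) : Op I := A ∘L ρ ∘L ContinuousLinearMap.adjoint A

/-! ## Binary measurements -/

/-- A binary measurement, given by its two Kraus operators. -/
structure BinMeas (I : Type*) where
  onTrue : Op I
  onFalse : Op I
  complete : ContinuousLinearMap.adjoint onTrue ∘L onTrue +
    ContinuousLinearMap.adjoint onFalse ∘L onFalse = ContinuousLinearMap.id ℂ (Ell2 I)

/-- The orthogonal projector onto the closed linear span of a set of vectors. -/
def projOnto {I : Type*} (S : Set (Ell2 I)) : Op I :=
  haveI : CompleteSpace (Submodule.span ℂ S).topologicalClosure :=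
    (Submodule.isClosed_topologicalClosure _).completeSpace_coe
  (Submodule.span ℂ S).topologicalClosure.starProjection

theorem isStarProjection_projOnto {I : Type*} (S : Set (Ell2 I)) :
    IsStarProjection (projOnto S) := by
  have : CompleteSpace (Submodule.span ℂ S).topologicalClosure :=
    (Submodule.isClosed_topologicalClosure _).completeSpace_coe
  exact ⟨Submodule.isIdempotentElem_starProjection _, isSelfAdjoint_starProjection _⟩

/-- The measurement `{P, id - P}` of a projector `P`. -/
def BinMeas.ofProj {I : Type*} (P : Op I) (hP : IsStarProjection P) : BinMeas I where
  onTrue := P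
  onFalse := ContinuousLinearMap.id ℂ (Ell2 I) - P
  complete := by
    have h1 : ContinuousLinearMap.adjoint P = P := hP.isSelfAdjoint
    have h2 : ContinuousLinearMap.adjoint (ContinuousLinearMap.id ℂ (Ell2 I) - P) =
        ContinuousLinearMap.id ℂ (Ell2 I) - P := hP.one_sub.isSelfAdjoint
    have h3 : P ∘L P = P := hP.isIdempotentElem
    have h4 : (ContinuousLinearMap.id ℂ (Ell2 I) - P) ∘L (ContinuousLinearMap.id ℂ (Ell2 I) - P) =
        ContinuousLinearMap.id ℂ (Ell2 I) - P := hP.one_sub.isIdempotentElem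
    rw [h1, h2, h3, h4]
    abel

/-- Transport of a measurement along `ℓ²(I) ≅ ℓ²(J)`. -/
def BinMeas.relabel {I J : Type*} (e : I ≃ J) (M : BinMeas I) : BinMeas J where
  onTrue := relabelOp e M.onTrue
  onFalse := relabelOp e M.onFalse
  complete := by
    refine ContinuousLinearMap.ext fun ψ => ext_inner_left ℂ fun χ => ?_
    have h := congrArg (fun B : Op I => ⟪(QRHL.relabel e).symm χ, B ((QRHL.relabel e).symm ψ)⟫_ℂ)
      M.complete
    simp only [add_apply, ContinuousLinearMap.comp_apply, inner_add_right,
      ContinuousLinearMap.adjoint_inner_right, ContinuousLinearMap.id_apply,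
      LinearIsometryEquiv.inner_map_map] at h ⊢
    simpa [relabelOp] using h

/-! ## Variables and programs -/

variable {V : Type*}

/-- Assignments to the variables in `X`, where the variable `v` has type `T v`. -/
abbrev Assign (T : V → Type*) (X : Set V) : Type _ := ∀ v : X, T v

/-- Assignments to all program variables. -/
abbrev Memory (T : V → Type*) : Type _ := ∀ v : V, T v

/-- An assignment to one variable is a value of its type. -/
def assignOne (T : V → Type*) (x : V) : Assign T {x} ≃ T x :=
  Equiv.piUnique (fun v : ({x} : Set V) => T v)

open Classical in
/-- An assignment to two distinct variables is a pair of values. -/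
def assignTwo (T : V → Type*) {x y : V} (h : x ≠ y) : Assign T {x, y} ≃ T x × T y where
  toFun m := (m ⟨x, by simp⟩, m ⟨y, by simp⟩)
  invFun p v := if hx : v.1 = x then cast (congrArg T hx.symm) p.1 else
    cast (congrArg T ((Set.mem_insert_iff.1 v.2).resolve_left hx).symm) p.2
  left_inv m := by
    funext v
    obtain ⟨v, hv⟩ := v
    by_cases hx : v = x
    · subst hx
      simp
    · obtain rfl : v = y := (Set.mem_insert_iff.1 hv).resolve_left hx
      simp [hx]
  right_inv p := by
    simp [h.symm]

open Classical in
/-- Splitting a memory into the parts inside and outside `X`. -/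
def split (T : V → Type*) (X : Set V) : Memory T ≃ Assign T X × Assign T Xᶜ :=
  Equiv.piEquivPiSubtypeProd (fun v => v ∈ X) T

/-- The operator `A` on the variables `X`, seen as the operator `A ⊗ id` on all variables. -/
def onVars {T : V → Type*} (X : Set V) (A : Op (Assign T X)) : Op (Memory T) :=
  relabelOp (split T X).symm (ampLeft A)

/-- Syntax of quantum programs. -/
inductive Prog (T : V → Type*)
  | apply (X : Set V) (U : Ell2 (Assign T X) →ₗᵢ[ℂ] Ell2 (Assign T X)) : Prog T
  | init (X : Set V) (ψ : Ell2 (Assign T X)) (hψ : ‖ψ‖ = 1) : Prog T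
  | ite (X : Set V) (M : BinMeas (Assign T X)) (c d : Prog T) : Prog T
  | while (X : Set V) (M : BinMeas (Assign T X)) (c : Prog T) : Prog T
  | seq (c d : Prog T) : Prog T
  | skip : Prog T

/-- Denotational semantics of programs, as a function on mixed memories (given by the same
formulas on all bounded operators). -/
def denot {T : V → Type*} : Prog T → Op (Memory T) → Op (Memory T)
  | .apply X U, ρ => conj (onVars X U.toContinuousLinearMap) ρ
  | .init X ψ _, ρ =>
      relabelOp (split T X).symm (tensorOp (proj ψ) (traceFst (relabelOp (split T X) ρ)))
  | .ite X M c d, ρ =>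
      denot c (conj (onVars X M.onTrue) ρ) + denot d (conj (onVars X M.onFalse) ρ)
  | .while X M c, ρ =>
      ∑' k : ℕ, conj (onVars X M.onFalse)
        ((fun σ => denot c (conj (onVars X M.onTrue) σ))^[k] ρ)
  | .seq c d, ρ => denot d (denot c ρ)
  | .skip, ρ => ρ

/-- The state of the variables `X`: all other variables are traced out. -/
def marginal {T : V → Type*} (X : Set V) (ρ : Op (Memory T)) : Op (Assign T X) :=
  traceSnd (relabelOp (split T X) ρ)

/-! ## Expectation-qRHL -/

/-- The judgment `{A} c ~ d {B}`; the pre- and postexpectations `A`, `B` are positive bounded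
operators on the memories of two copies of the program variables. -/
def Rhl {T : V → Type*} (A : Op (Memory T × Memory T)) (c d : Prog T)
    (B : Op (Memory T × Memory T)) : Prop :=
  A.IsPositive ∧ B.IsPositive ∧
    ∀ ρ : Op (Memory T × Memory T), IsSeparable ρ →
      ∃ ρ' : Op (Memory T × Memory T), IsSeparable ρ' ∧
        traceSnd ρ' = denot c (traceSnd ρ) ∧
        traceFst ρ' = denot d (traceFst ρ) ∧
        (trace (A ∘L ρ)).re ≤ (trace (B ∘L ρ')).re

/-- The swap `φ ⊗ χ ↦ χ ⊗ φ`. -/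
def swapOp (I : Type*) : Op (I × I) :=
  (relabel (Equiv.prodComm I I)).toContinuousLinearEquiv.toContinuousLinearMap

/-- The projector `EQUAL` onto the subspace of vectors that are invariant under the swap. -/
def equalOp (I : Type*) : Op (I × I) :=
  projOnto {ψ : Ell2 (I × I) | swapOp I ψ = ψ}

/-- Splitting a pair of memories into the two copies of `X` and the two copies of the
remaining variables. -/
def splitPair (T : V → Type*) (X : Set V) :
    Memory T × Memory T ≃ (Assign T X × Assign T X) × (Assign T Xᶜ × Assign T Xᶜ) :=
  (Equiv.prodCongr (split T X) (split T X)).trans (Equiv.prodProdProdComm _ _ _ _)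

/-- The expectation `EQUAL` on the two copies of the variables `X`. -/
def equalOn {T : V → Type*} (X : Set V) : Op (Memory T × Memory T) :=
  relabelOp (splitPair T X).symm (ampLeft (equalOp (Assign T X)))

/-! ## The quantum Zeno programs -/

/-- The isometry of `ℓ²(I)` given by an isometric matrix. -/
def matrixIso {I : Type*} [Fintype I] [DecidableEq I] (M : Matrix I I ℂ)
    (hM : M.conjTranspose * M = 1) : Ell2 I →ₗᵢ[ℂ] Ell2 I where
  toFun ψ := ⟨M.mulVec (fun i => ψ i), Memℓp.all _⟩
  map_add' ψ χ := by
    apply lp.ext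
    exact M.mulVec_add (fun i => ψ i) (fun i => χ i)
  map_smul' c ψ := by
    apply lp.ext
    exact M.mulVec_smul c (fun i => ψ i)
  norm_map' ψ := by
    refine (sq_eq_sq₀ (norm_nonneg _) (norm_nonneg _)).1 ?_
    rw [norm_sq_eq, norm_sq_eq, tsum_fintype, tsum_fintype]
    have key : ∀ v : I → ℂ, ((∑ i, ‖v i‖ ^ 2 : ℝ) : ℂ) = star v ⬝ᵥ v := by
      intro v
      simp [dotProduct, Complex.conj_mul']
    apply Complex.ofReal_injective
    rw [key, key]
    change star (M.mulVec fun i => ψ i) ⬝ᵥ (M.mulVec fun i => ψ i) = _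
    rw [Matrix.star_mulVec, Matrix.dotProduct_mulVec, Matrix.vecMul_vecMul, hM,
      Matrix.vecMul_one]

/-- The rotation matrix by the angle `π / (2 n)`. -/
def rotMatrix (n : ℕ) : Matrix (Fin 2) (Fin 2) ℂ :=
  !![(Real.cos (Real.pi / (2 * n)) : ℂ), -(Real.sin (Real.pi / (2 * n)) : ℂ);
     (Real.sin (Real.pi / (2 * n)) : ℂ), (Real.cos (Real.pi / (2 * n)) : ℂ)]

theorem rotMatrix_isometric (n : ℕ) : (rotMatrix n).conjTranspose * rotMatrix n = 1 := by
  have h : (Real.cos (Real.pi / (2 * n)) : ℂ) ^ 2 + (Real.sin (Real.pi / (2 * n)) : ℂ) ^ 2 = 1 := by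
    exact_mod_cast Real.cos_sq_add_sin_sq (Real.pi / (2 * n))
  ext i j
  fin_cases i <;> fin_cases j <;>
    simp only [rotMatrix, Matrix.mul_apply, Matrix.conjTranspose_apply, Fin.sum_univ_two,
      Matrix.of_apply, Matrix.cons_val', Matrix.cons_val_zero, Matrix.cons_val_one,
      Matrix.cons_val_fin_one, Fin.zero_eta, Fin.mk_one, Fin.isValue,
      Complex.star_def, Complex.conj_ofReal, map_neg, Matrix.one_apply_eq, ne_eq, zero_ne_one, one_ne_zero,
      not_false_eq_true, Matrix.one_apply_ne]
  · linear_combination h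
  · ring
  · ring
  · linear_combination h

/-- The rotation `R` of a qubit. -/
def rot (n : ℕ) : Ell2 (Fin 2) →ₗᵢ[ℂ] Ell2 (Fin 2) := matrixIso (rotMatrix n) (rotMatrix_isometric n)

/-- The states `φ₀ = |0⟩`, `φᵢ₊₁ = R φᵢ`. -/
def phi (n : ℕ) : ℕ → Ell2 (Fin 2)
  | 0 => ket 0
  | i + 1 => rot n (phi n i)

/-- The shift `|i⟩ ↦ |i + 1⟩` on `ℓ²(ℤ)`. -/
def incr : Ell2 ℤ →ₗᵢ[ℂ] Ell2 ℤ := (relabel (Equiv.addRight (1 : ℤ))).toLinearIsometry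

/-- The measurement of the projector `P_{<n}` onto the span of the `|i⟩` with `i < n`. -/
def measLt (n : ℕ) : BinMeas ℤ :=
  .ofProj (projOnto {ψ | ∃ i : ℤ, i < n ∧ ψ = ket i}) (isStarProjection_projOnto _)

/-- The measurement of the projector `P_φ = ∑ᵢ |i ⊗ φᵢ⟩⟨i ⊗ φᵢ|` onto the closed span of the
orthonormal family of vectors `|i⟩ ⊗ φᵢ`, `i ≥ 0`. -/
def measPhi (n : ℕ) : BinMeas (ℤ × Fin 2) :=
  .ofProj (projOnto (Set.range fun i : ℕ => tensorVec (ket (i : ℤ)) (phi n i)))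
    (isStarProjection_projOnto _)

theorem norm_ket {I : Type*} (i : I) : ‖ket i‖ = 1 := by
  classical
  have h := lp.norm_single (E := fun _ : I => ℂ) (p := 2) (by norm_num) i (1 : ℂ)
  rw [norm_one] at h
  rw [← h, ket]

section Zeno

variable {T : V → Type*} {x y : V} (hxy : x ≠ y) (ex : T x ≃ ℤ) (ey : T y ≃ Fin 2)

/-- Initialization of a variable `v` (with values in `S`) with the basis state `|s⟩`. -/
def initKet {v : V} {S : Type*} (e : T v ≃ S) (s : S) : Prog T :=
  .init {v} (relabel ((assignOne T v).trans e).symm (ket s)) (by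
    rw [LinearIsometryEquiv.norm_map, norm_ket])

/-- `init x |0⟩; init y |0⟩; while P_{<n} x do body`. -/
def zenoLoop (n : ℕ) (body : Prog T) : Prog T :=
  .seq (initKet ex 0) (.seq (initKet ey 0)
    (.while {x} ((measLt n).relabel ((assignOne T x).trans ex).symm) body))

/-- `apply incr x`. -/
def applyIncr : Prog T := .apply {x} (relabelIso ((assignOne T x).trans ex).symm incr)

/-- The program with `n` rotations: the loop body is `apply incr x; apply R y`. -/
def zenoRotate (n : ℕ) : Prog T :=
  zenoLoop ex ey n (.seq (applyIncr ex)
    (.apply {y} (relabelIso ((assignOne T y).trans ey).symm (rot n))))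

/-- The program with `n` measurements: the loop body is
`apply incr x; if P_φ xy then skip else skip`. -/
def zenoMeasure (n : ℕ) : Prog T :=
  zenoLoop ex ey n (.seq (applyIncr ex)
    (.ite {x, y} ((measPhi n).relabel ((assignTwo T hxy).trans (Equiv.prodCongr ex ey)).symm)
      .skip .skip))

end Zeno

/-- `ε = cos² (π / (2 n))`. -/
def zenoEps (n : ℕ) : ℝ := Real.cos (Real.pi / (2 * n)) ^ 2

end QRHL

end

open QRHL

/-! In both programs `x` is a classical counter. The initializations turn any mixed state into
`|0⟩⟨0| ⊗ |0⟩⟨0| ⊗ τ` with `τ` of the same trace on the other variables, and each pass of the loop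
maps a state `|k⟩⟨k| ⊗ ω k ⊗ τ` to `|k+1⟩⟨k+1| ⊗ ω (k+1) ⊗ τ`. The guard fails for the first time at
`k = n`, so exactly one term of the sum interpreting `while` is nonzero (`denot_while_loopState`).

Put `θ = π/(2n)` and let `φ_k` be the real qubit at angle `kθ`. Rotation yields `ω k = |φ_k⟩⟨φ_k|`.
Measurement yields a mixture of `φ_k`, with weight `a_k`, and the orthogonal qubit. Since `φ_k` and
`φ_{k+1}` enclose the angle `θ`, the weights satisfy `a_{k+1} = a_k ε + (1 - a_k)(1 - ε)` with `ε =
cos² θ`, hence `a_n ≥ ε^n` (`denot_measureBody`, `zenoEps_pow_le_zenoProb`).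

For the judgment, the normalized product of the two outputs is a separable coupling
(`exists_product_coupling`). The symmetric vector `φ_n ⊗ φ_n` occurs in it with relative weight
`a_n`, so EQUAL has expectation at least `ε^n` times the trace (`le_re_trace_equalOp`). Bernoulli's
inequality gives `ε^n ≥ 1 - π²/(4n)`, and the final states of `y` differ in operator norm by at most
`2 (1 - ε^n)`. -/

noncomputable section

namespace QRHL

open scoped InnerProductSpace

/-! ## Matrix entries -/

section Entries

variable {I J K L : Type*}

open Classical in
theorem ket_apply (i j : I) : ket i j = if j = i then 1 else 0 := by
  rw [ket, lp.single_apply]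
  by_cases h : j = i
  · subst h; simp
  · simp [h]

theorem ket_apply_self (i : I) : ket i i = 1 := by simp [ket_apply]

theorem ket_apply_ne {i j : I} (h : j ≠ i) : ket i j = 0 := by simp [ket_apply, h]

theorem inner_ket_left (i : I) (ψ : Ell2 I) : ⟪ket i, ψ⟫_ℂ = ψ i := by
  classical
  have h := lp.inner_single_left (𝕜 := ℂ) (G := fun _ : I => ℂ) i (1 : ℂ) ψ
  rw [ket]
  convert h using 1
  simp

theorem hasSum_ket (ψ : Ell2 I) : HasSum (fun i => ψ i • ket i) ψ := by
  classical
  have h := lp.hasSum_single (E := fun _ : I => ℂ) (p := 2) (by norm_num) ψ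
  have e : (fun i => ψ i • ket i) = fun i => lp.single (E := fun _ : I => ℂ) 2 i (ψ i) := by
    funext i
    rw [ket, ← lp.single_smul, smul_eq_mul, mul_one]
  rw [e]
  exact h

/-- The matrix entry `⟨i|A|j⟩`. -/
def entry (A : Ell2 J →L[ℂ] Ell2 I) (i : I) (j : J) : ℂ := A (ket j) i

theorem inner_ket_apply_ket (A : Op I) (i j : I) : ⟪ket i, A (ket j)⟫_ℂ = entry A i j :=
  inner_ket_left _ _

/-- Continuity carries agreement on basis vectors through the norm-convergent expansion
`hasSum_ket`. -/
theorem op_ext_ket {A B : Ell2 J →L[ℂ] Ell2 I} (h : ∀ j, A (ket j) = B (ket j)) : A = B := by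
  ext1 ψ
  have hA := A.hasSum (hasSum_ket ψ)
  have hB := B.hasSum (hasSum_ket ψ)
  simp only [map_smul, h] at hA hB
  exact hA.unique hB

/-- Most operator identities below are reduced by this to scalar identities between matrix entries,
where relabelling is a change of indices. -/
theorem op_ext_entry {A B : Ell2 J →L[ℂ] Ell2 I} (h : ∀ i j, entry A i j = entry B i j) :
    A = B :=
  op_ext_ket fun j => lp.ext (funext fun i => h i j)

theorem entry_add (A B : Ell2 J →L[ℂ] Ell2 I) (i : I) (j : J) :
    entry (A + B) i j = entry A i j + entry B i j := rfl

theorem entry_smul (c : ℂ) (A : Ell2 J →L[ℂ] Ell2 I) (i : I) (j : J) :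
    entry (c • A) i j = c * entry A i j := rfl

theorem trace_eq_tsum_entry (A : Op I) : trace A = ∑' i, entry A i i :=
  tsum_congr fun i => inner_ket_apply_ket A i i

theorem relabel_apply (e : I ≃ J) (ψ : Ell2 I) (j : J) : relabel e ψ j = ψ (e.symm j) := rfl

theorem relabel_symm (e : I ≃ J) : (relabel e).symm = relabel e.symm := by
  ext1 ψ
  apply lp.ext
  rfl

theorem relabel_ket (e : I ≃ J) (i : I) : relabel e (ket i) = ket (e i) := by
  classical
  apply lp.ext
  funext j
  rw [relabel_apply, ket_apply, ket_apply]
  simp [Equiv.symm_apply_eq]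

theorem relabelOp_apply (e : I ≃ J) (A : Op I) (ψ : Ell2 J) :
    relabelOp e A ψ = relabel e (A (relabel e.symm ψ)) := rfl

theorem entry_relabelOp (e : I ≃ J) (A : Op I) (i j : J) :
    entry (relabelOp e A) i j = entry A (e.symm i) (e.symm j) := by
  rw [entry, relabelOp_apply, relabel_ket]
  rfl

theorem relabelOp_trans (e : I ≃ J) (f : J ≃ K) (A : Op I) :
    relabelOp f (relabelOp e A) = relabelOp (e.trans f) A := rfl

theorem relabelOp_symm_self (e : I ≃ J) (A : Op J) : relabelOp e (relabelOp e.symm A) = A := by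
  refine op_ext_entry fun i j => ?_
  simp [entry_relabelOp]

theorem relabelOp_self_symm (e : I ≃ J) (A : Op I) : relabelOp e.symm (relabelOp e A) = A :=
  relabelOp_symm_self e.symm A

theorem relabelOp_add (e : I ≃ J) (A B : Op I) :
    relabelOp e (A + B) = relabelOp e A + relabelOp e B := by
  refine op_ext_entry fun i j => ?_
  simp only [entry_relabelOp, entry_add]

theorem relabelOp_smul (e : I ≃ J) (c : ℂ) (A : Op I) :
    relabelOp e (c • A) = c • relabelOp e A := by
  refine op_ext_entry fun i j => ?_
  simp only [entry_relabelOp, entry_smul]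

theorem relabelOp_comp (e : I ≃ J) (A B : Op I) :
    relabelOp e (A ∘L B) = relabelOp e A ∘L relabelOp e B := by
  ext1 ψ
  simp only [relabelOp_apply, ContinuousLinearMap.comp_apply]
  congr 2
  rw [← relabel_symm, LinearIsometryEquiv.symm_apply_apply]

theorem adjoint_relabelOp (e : I ≃ J) (A : Op I) :
    ContinuousLinearMap.adjoint (relabelOp e A) = relabelOp e (ContinuousLinearMap.adjoint A) := by
  symm
  rw [ContinuousLinearMap.eq_adjoint_iff]
  intro φ ψ
  rw [relabelOp_apply, relabelOp_apply, ← relabel_symm, LinearIsometryEquiv.inner_map_eq_flip,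
    ContinuousLinearMap.adjoint_inner_left]
  exact LinearIsometryEquiv.inner_map_eq_flip (relabel e).symm _ _

theorem conj_relabelOp (e : I ≃ J) (A B : Op I) :
    conj (relabelOp e A) (relabelOp e B) = relabelOp e (conj A B) := by
  simp only [conj, adjoint_relabelOp, relabelOp_comp]

/-! ## Tensor products -/

theorem tensorVec_apply (φ : Ell2 I) (χ : Ell2 J) (p : I × J) :
    tensorVec φ χ p = φ p.1 * χ p.2 := rfl

theorem ket_prod (i : I) (j : J) : ket (i, j) = tensorVec (ket i) (ket j) := by
  classical
  apply lp.ext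
  funext p
  rw [tensorVec_apply, ket_apply, ket_apply, ket_apply]
  by_cases h1 : p.1 = i <;> by_cases h2 : p.2 = j <;> simp [Prod.ext_iff, h1, h2]

theorem slice_apply (j : J) (ψ : Ell2 (I × J)) (i : I) :
    (slice j : Ell2 (I × J) →L[ℂ] Ell2 I) ψ i = ψ (i, j) := rfl

theorem ampLeft_apply (A : Op I) (ψ : Ell2 (I × J)) (p : I × J) :
    ampLeft A ψ p = A (slice p.2 ψ) p.1 := rfl

theorem slice_tensorVec (j : J) (φ : Ell2 I) (χ : Ell2 J) :
    slice j (tensorVec φ χ) = χ j • φ := by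
  apply lp.ext
  funext i
  exact mul_comm _ _

theorem ampLeft_tensorVec (A : Op I) (φ : Ell2 I) (χ : Ell2 J) :
    ampLeft A (tensorVec φ χ) = tensorVec (A φ) χ := by
  apply lp.ext
  funext p
  rw [ampLeft_apply, slice_tensorVec, map_smul]
  exact mul_comm _ _

theorem relabel_prodComm_tensorVec (φ : Ell2 I) (χ : Ell2 J) :
    relabel (Equiv.prodComm I J) (tensorVec φ χ) = tensorVec χ φ := by
  apply lp.ext
  funext p
  exact mul_comm _ _

theorem ampRight_tensorVec (B : Op J) (φ : Ell2 I) (χ : Ell2 J) :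
    ampRight B (tensorVec φ χ) = tensorVec φ (B χ) := by
  rw [ampRight, relabelOp_apply, Equiv.prodComm_symm, relabel_prodComm_tensorVec,
    ampLeft_tensorVec, relabel_prodComm_tensorVec]

theorem tensorOp_tensorVec (A : Op I) (B : Op J) (φ : Ell2 I) (χ : Ell2 J) :
    tensorOp A B (tensorVec φ χ) = tensorVec (A φ) (B χ) := by
  rw [tensorOp, ContinuousLinearMap.comp_apply, ampRight_tensorVec, ampLeft_tensorVec]

theorem entry_tensorOp (A : Op I) (B : Op J) (p q : I × J) :
    entry (tensorOp A B) p q = entry A p.1 q.1 * entry B p.2 q.2 := by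
  rw [entry, ← Prod.mk.eta (p := q), ket_prod, tensorOp_tensorVec]
  rfl

open Classical in
theorem entry_ampLeft (A : Op I) (p q : I × J) :
    entry (ampLeft A) p q = if p.2 = q.2 then entry A p.1 q.1 else 0 := by
  rw [entry, ← Prod.mk.eta (p := q), ket_prod, ampLeft_tensorVec, tensorVec_apply, ket_apply,
    mul_ite, mul_one, mul_zero]
  rfl

open Classical in
theorem entry_ampRight (B : Op J) (p q : I × J) :
    entry (ampRight B) p q = if p.1 = q.1 then entry B p.2 q.2 else 0 := by
  rw [entry, ← Prod.mk.eta (p := q), ket_prod, ampRight_tensorVec, tensorVec_apply, ket_apply,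
    ite_mul, one_mul, zero_mul]
  rfl

/-- Operators on a product that agree on product vectors are equal. -/
theorem op_ext_tensorVec {A B : Ell2 (I × J) →L[ℂ] Ell2 K}
    (h : ∀ i j, A (tensorVec (ket i) (ket j)) = B (tensorVec (ket i) (ket j))) : A = B :=
  op_ext_ket fun p => by rw [← Prod.mk.eta (p := p), ket_prod, h]

theorem ampLeft_comp (A B : Op I) :
    (ampLeft (A ∘L B) : Op (I × J)) = ampLeft A ∘L ampLeft B :=
  op_ext_tensorVec fun i j => by
    simp only [ContinuousLinearMap.comp_apply, ampLeft_tensorVec]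

theorem ampLeft_comp_ampRight (A : Op I) (B : Op J) :
    ampLeft A ∘L ampRight B = ampRight B ∘L ampLeft A :=
  op_ext_tensorVec fun i j => by
    simp only [ContinuousLinearMap.comp_apply, ampLeft_tensorVec, ampRight_tensorVec]

theorem ampLeft_comp_tensorOp (C A : Op I) (B : Op J) :
    ampLeft C ∘L tensorOp A B = tensorOp (C ∘L A) B :=
  op_ext_tensorVec fun i j => by
    simp only [ContinuousLinearMap.comp_apply, ampLeft_tensorVec, tensorOp_tensorVec]

theorem entry_adjoint (A : Ell2 J →L[ℂ] Ell2 I) (i : I) (j : J) :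
    entry (ContinuousLinearMap.adjoint A) j i = star (entry A i j) := by
  rw [entry, ← inner_ket_left, ContinuousLinearMap.adjoint_inner_right, ← inner_conj_symm,
    inner_ket_left]
  rfl

theorem adjoint_ampLeft (A : Op I) :
    ContinuousLinearMap.adjoint (ampLeft A : Op (I × J)) =
      ampLeft (ContinuousLinearMap.adjoint A) := by
  classical
  refine op_ext_entry fun p q => ?_
  rw [entry_adjoint, entry_ampLeft, entry_ampLeft, entry_adjoint]
  simp only [eq_comm (a := q.2)]
  split_ifs <;> simp

theorem adjoint_ampRight (B : Op J) :
    ContinuousLinearMap.adjoint (ampRight B : Op (I × J)) =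
      ampRight (ContinuousLinearMap.adjoint B) := by
  rw [ampRight, adjoint_relabelOp, adjoint_ampLeft]
  rfl

theorem tensorOp_comp_tensorOp (A C : Op I) (B D : Op J) :
    tensorOp A B ∘L tensorOp C D = tensorOp (A ∘L C) (B ∘L D) :=
  op_ext_tensorVec fun i j => by
    simp only [ContinuousLinearMap.comp_apply, tensorOp_tensorVec]

theorem adjoint_tensorOp (A : Op I) (B : Op J) :
    ContinuousLinearMap.adjoint (tensorOp A B) =
      tensorOp (ContinuousLinearMap.adjoint A) (ContinuousLinearMap.adjoint B) := by
  rw [tensorOp, ContinuousLinearMap.adjoint_comp, adjoint_ampLeft, adjoint_ampRight,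
    ← ampLeft_comp_ampRight]
  rfl

theorem tensorOp_add_left (A B : Op I) (C : Op J) :
    tensorOp (A + B) C = tensorOp A C + tensorOp B C := by
  refine op_ext_entry fun i j => ?_
  simp only [entry_tensorOp, entry_add, add_mul]

theorem tensorOp_add_right (A : Op I) (B C : Op J) :
    tensorOp A (B + C) = tensorOp A B + tensorOp A C := by
  refine op_ext_entry fun i j => ?_
  simp only [entry_tensorOp, entry_add, mul_add]

theorem tensorOp_smul_left (c : ℂ) (A : Op I) (C : Op J) :
    tensorOp (c • A) C = c • tensorOp A C := by
  refine op_ext_entry fun i j => ?_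
  simp only [entry_tensorOp, entry_smul, mul_assoc]

theorem tensorOp_smul_right (c : ℂ) (A : Op I) (C : Op J) :
    tensorOp A (c • C) = c • tensorOp A C := by
  refine op_ext_entry fun i j => ?_
  simp only [entry_tensorOp, entry_smul, mul_left_comm]

theorem conj_ampLeft_tensorOp (C A : Op I) (B : Op J) :
    conj (ampLeft C) (tensorOp A B) = tensorOp (conj C A) B := by
  refine op_ext_tensorVec fun i j => ?_
  simp only [conj, adjoint_ampLeft, ContinuousLinearMap.comp_apply, ampLeft_tensorVec,
    tensorOp_tensorVec]

theorem relabelOp_prodCongr_tensorOp (e : I ≃ K) (f : J ≃ L) (A : Op I) (B : Op J) :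
    relabelOp (e.prodCongr f) (tensorOp A B) = tensorOp (relabelOp e A) (relabelOp f B) := by
  refine op_ext_entry fun i j => ?_
  simp only [entry_tensorOp, entry_relabelOp]
  rfl

theorem relabelOp_prodCongr_ampLeft (e : I ≃ K) (f : J ≃ L) (A : Op I) :
    relabelOp (e.prodCongr f) (ampLeft A) = ampLeft (relabelOp e A) := by
  classical
  refine op_ext_entry fun i j => ?_
  simp only [entry_ampLeft, entry_relabelOp]
  simp

theorem relabelOp_prodComm_tensorOp (A : Op I) (B : Op J) :
    relabelOp (Equiv.prodComm I J) (tensorOp A B) = tensorOp B A := by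
  refine op_ext_entry fun i j => ?_
  simp only [entry_tensorOp, entry_relabelOp]
  exact mul_comm _ _

/-! ## Rank-one projections and conjugation -/

theorem proj_apply (ψ φ : Ell2 I) : proj ψ φ = ⟪ψ, φ⟫_ℂ • ψ := rfl

theorem entry_proj (ψ : Ell2 I) (i j : I) : entry (proj ψ) i j = ψ i * star (ψ j) := by
  rw [entry, proj_apply, ← inner_conj_symm, inner_ket_left]
  exact mul_comm _ _

/-- On pure states the semantics thereby reduces to the action of Kraus operators on vectors. -/
theorem conj_proj (A : Op I) (ψ : Ell2 I) : conj A (proj ψ) = proj (A ψ) := by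
  ext1 φ
  simp only [conj, ContinuousLinearMap.comp_apply, proj_apply, map_smul,
    ContinuousLinearMap.adjoint_inner_right]

theorem conj_add (A B C : Op I) : conj A (B + C) = conj A B + conj A C := by
  simp [conj]

theorem conj_smul (c : ℂ) (A B : Op I) : conj A (c • B) = c • conj A B := by
  simp [conj]

theorem conj_zero (A : Op I) : conj A 0 = 0 := by
  simp [conj]

/-- The factor `|c|²` is the source of the measurement probabilities. -/
theorem proj_smul (c : ℂ) (ψ : Ell2 I) : proj (c • ψ) = (c * star c) • proj ψ := by
  refine op_ext_entry fun i j => ?_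
  rw [entry_smul, entry_proj, entry_proj]
  simp only [lp.coeFn_smul, Pi.smul_apply, smul_eq_mul, star_mul']
  ring

theorem tensorOp_proj (φ : Ell2 I) (χ : Ell2 J) :
    tensorOp (proj φ) (proj χ) = proj (tensorVec φ χ) := by
  refine op_ext_entry fun p q => ?_
  simp only [entry_tensorOp, entry_proj, tensorVec_apply, star_mul']
  ring

theorem relabelOp_proj (e : I ≃ J) (ψ : Ell2 I) : relabelOp e (proj ψ) = proj (relabel e ψ) := by
  refine op_ext_entry fun i j => ?_
  simp only [entry_relabelOp, entry_proj]
  rfl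

end Entries

/-! ## Mixed states -/

section Mixed

variable {I J K L : Type*}

/-- With `S` the positive square root, positivity of tensor products and relabellings becomes
algebra of adjoints. -/
theorem exists_adjoint_comp_self {H : Type*} [NormedAddCommGroup H] [InnerProductSpace ℂ H]
    [CompleteSpace H] {A : H →L[ℂ] H} (hA : A.IsPositive) :
    ∃ S : H →L[ℂ] H, A = ContinuousLinearMap.adjoint S ∘L S := by
  have h0 : 0 ≤ A := (ContinuousLinearMap.nonneg_iff_isPositive A).2 hA
  refine ⟨CFC.sqrt A, ?_⟩
  have h1 : IsSelfAdjoint (CFC.sqrt A) := IsSelfAdjoint.of_nonneg (CFC.sqrt_nonneg A)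
  have h2 : ContinuousLinearMap.adjoint (CFC.sqrt A) = CFC.sqrt A := h1
  rw [h2]
  exact (CFC.sqrt_mul_sqrt_self A h0).symm

theorem isPositive_adjoint_comp_self (S : Ell2 I →L[ℂ] Ell2 J) :
    (ContinuousLinearMap.adjoint S ∘L S).IsPositive := by
  exact ContinuousLinearMap.isPositive_adjoint_comp_self S

theorem isPositive_ampLeft {A : Op I} (hA : A.IsPositive) :
    (ampLeft A : Op (I × J)).IsPositive := by
  obtain ⟨S, rfl⟩ := exists_adjoint_comp_self hA
  rw [ampLeft_comp, ← adjoint_ampLeft]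
  exact isPositive_adjoint_comp_self _

theorem isPositive_relabelOp (e : I ≃ J) {A : Op I} (hA : A.IsPositive) :
    (relabelOp e A).IsPositive := by
  obtain ⟨S, rfl⟩ := exists_adjoint_comp_self hA
  rw [relabelOp_comp, ← adjoint_relabelOp]
  exact isPositive_adjoint_comp_self _

theorem isPositive_tensorOp {A : Op I} {B : Op J} (hA : A.IsPositive) (hB : B.IsPositive) :
    (tensorOp A B).IsPositive := by
  obtain ⟨S, rfl⟩ := exists_adjoint_comp_self hA
  obtain ⟨R, rfl⟩ := exists_adjoint_comp_self hB
  rw [← tensorOp_comp_tensorOp, ← adjoint_tensorOp]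
  exact isPositive_adjoint_comp_self _

/-- Cauchy–Schwarz for `S φ` and `S ψ`, where `A = S† S`. -/
theorem norm_inner_sq_le {A : Op I} (hA : A.IsPositive) (φ ψ : Ell2 I) :
    ‖⟪φ, A ψ⟫_ℂ‖ ^ 2 ≤ (⟪φ, A φ⟫_ℂ).re * (⟪ψ, A ψ⟫_ℂ).re := by
  obtain ⟨S, rfl⟩ := exists_adjoint_comp_self hA
  simp only [ContinuousLinearMap.comp_apply, ContinuousLinearMap.adjoint_inner_right,
    inner_self_eq_norm_sq_to_K]
  have h : ∀ r : ℝ, (((r : ℂ)) ^ 2).re = r ^ 2 := fun r => by norm_cast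
  simp only [Complex.coe_algebraMap, h]
  rw [← mul_pow]
  exact pow_le_pow_left₀ (norm_nonneg _) (norm_inner_le_norm _ _) 2

theorem re_inner_self_nonneg {A : Op I} (hA : A.IsPositive) (φ : Ell2 I) :
    0 ≤ (⟪φ, A φ⟫_ℂ).re := by
  obtain ⟨S, rfl⟩ := exists_adjoint_comp_self hA
  simp only [ContinuousLinearMap.comp_apply, ContinuousLinearMap.adjoint_inner_right]
  exact inner_self_nonneg (𝕜 := ℂ)

theorem entry_self_nonneg {A : Op I} (hA : A.IsPositive) (i : I) : 0 ≤ (entry A i i).re := by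
  rw [← inner_ket_apply_ket]
  exact re_inner_self_nonneg hA _

theorem ofReal_entry_self {A : Op I} (hA : A.IsPositive) (i : I) :
    ((entry A i i).re : ℂ) = entry A i i := by
  obtain ⟨S, rfl⟩ := exists_adjoint_comp_self hA
  rw [← inner_ket_apply_ket]
  simp only [ContinuousLinearMap.comp_apply, ContinuousLinearMap.adjoint_inner_right,
    inner_self_eq_norm_sq_to_K, Complex.coe_algebraMap]
  norm_cast

theorem isMixed_iff {ρ : Op I} :
    IsMixed ρ ↔ ρ.IsPositive ∧ Summable fun i => (entry ρ i i).re := by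
  refine and_congr_right fun hp => ?_
  simp only [inner_ket_apply_ket]
  rw [← Complex.summable_ofReal]
  simp only [ofReal_entry_self hp]

theorem IsMixed.summable_re {ρ : Op I} (h : IsMixed ρ) : Summable fun i => (entry ρ i i).re :=
  (isMixed_iff.1 h).2

theorem IsMixed.trace_eq {ρ : Op I} (h : IsMixed ρ) :
    trace ρ = ((∑' i, (entry ρ i i).re : ℝ) : ℂ) := by
  rw [trace_eq_tsum_entry, Complex.ofReal_tsum]
  simp only [ofReal_entry_self h.1]

theorem IsMixed.re_trace {ρ : Op I} (h : IsMixed ρ) :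
    (trace ρ).re = ∑' i, (entry ρ i i).re := by
  rw [h.trace_eq, Complex.ofReal_re]

theorem IsMixed.ofReal_re_trace {ρ : Op I} (h : IsMixed ρ) : ((trace ρ).re : ℂ) = trace ρ := by
  rw [h.re_trace, h.trace_eq]

theorem IsMixed.hasSum_entry {ρ : Op I} (h : IsMixed ρ) :
    HasSum (fun i => entry ρ i i) (trace ρ) := by
  rw [trace_eq_tsum_entry]
  simpa only [inner_ket_apply_ket] using h.2.hasSum

theorem IsMixed.re_trace_nonneg {ρ : Op I} (h : IsMixed ρ) : 0 ≤ (trace ρ).re := by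
  rw [h.re_trace]
  exact tsum_nonneg fun i => entry_self_nonneg h.1 i

/-- The operator norm of a mixed state is bounded by its trace. -/
theorem IsMixed.norm_le {ρ : Op I} (h : IsMixed ρ) : ‖ρ‖ ≤ (trace ρ).re := by
  refine ContinuousLinearMap.opNorm_le_bound _ h.re_trace_nonneg fun ψ => ?_
  -- Apply Cauchy–Schwarz to each coordinate, `|⟨i, ρ ψ⟩|² ≤ ρ_ii ⟨ψ, ρ ψ⟩`, and sum over `i`.
  have h1 : ‖ρ ψ‖ ^ 2 ≤ (trace ρ).re * (⟪ψ, ρ ψ⟫_ℂ).re := by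
    rw [norm_sq_eq, h.re_trace, ← tsum_mul_right]
    refine (summable_sq _).tsum_le_tsum (fun i => ?_) (h.summable_re.mul_right _)
    rw [← inner_ket_left, ← inner_ket_apply_ket]
    exact norm_inner_sq_le h.1 _ _
  have h2 : (⟪ψ, ρ ψ⟫_ℂ).re ≤ ‖ψ‖ * ‖ρ ψ‖ :=
    (Complex.re_le_norm _).trans (norm_inner_le_norm _ _)
  have h3 := mul_le_mul_of_nonneg_left h2 h.re_trace_nonneg
  rcases (norm_nonneg (ρ ψ)).eq_or_lt with h0 | h0
  · rw [← h0]
    exact mul_nonneg h.re_trace_nonneg (norm_nonneg _)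
  · refine le_of_mul_le_mul_right ?_ h0
    linarith

theorem IsMixed.eq_zero_of_trace {ρ : Op I} (h : IsMixed ρ) (h0 : trace ρ = 0) : ρ = 0 := by
  have := h.norm_le
  rw [h0, Complex.zero_re] at this
  exact norm_le_zero_iff.1 this

theorem IsMixed.add {ρ σ : Op I} (hρ : IsMixed ρ) (hσ : IsMixed σ) : IsMixed (ρ + σ) := by
  refine isMixed_iff.2 ⟨hρ.1.add hσ.1, ?_⟩
  simpa only [entry_add, Complex.add_re] using hρ.summable_re.add hσ.summable_re

theorem IsMixed.smul {ρ : Op I} (hρ : IsMixed ρ) {c : ℝ} (hc : 0 ≤ c) :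
    IsMixed ((c : ℂ) • ρ) := by
  refine isMixed_iff.2 ⟨hρ.1.smul_of_nonneg (by exact_mod_cast hc), ?_⟩
  simpa only [entry_smul, Complex.re_ofReal_mul] using hρ.summable_re.mul_left c

theorem trace_add {ρ σ : Op I} (hρ : IsMixed ρ) (hσ : IsMixed σ) :
    trace (ρ + σ) = trace ρ + trace σ := by
  refine HasSum.unique ?_ (hρ.hasSum_entry.add hσ.hasSum_entry)
  exact (hρ.add hσ).hasSum_entry

theorem trace_smul (c : ℂ) (A : Op I) : trace (c • A) = c * trace A := by
  rw [trace_eq_tsum_entry, trace_eq_tsum_entry, ← tsum_mul_left]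
  rfl

theorem isMixed_proj (ψ : Ell2 I) : IsMixed (proj ψ) := by
  refine isMixed_iff.2 ⟨InnerProductSpace.isPositive_rankOne_self ψ, ?_⟩
  refine (summable_sq ψ).congr fun i => ?_
  rw [entry_proj, Complex.star_def, Complex.mul_conj, Complex.normSq_eq_norm_sq,
    Complex.ofReal_re]

theorem trace_proj (ψ : Ell2 I) : trace (proj ψ) = ((‖ψ‖ ^ 2 : ℝ) : ℂ) := by
  rw [(isMixed_proj ψ).trace_eq, norm_sq_eq]
  congr 1
  refine tsum_congr fun i => ?_
  rw [entry_proj, Complex.star_def, Complex.mul_conj, Complex.normSq_eq_norm_sq,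
    Complex.ofReal_re]

theorem IsMixed.relabelOp {ρ : Op I} (h : IsMixed ρ) (e : I ≃ J) : IsMixed (relabelOp e ρ) := by
  refine isMixed_iff.2 ⟨isPositive_relabelOp e h.1, ?_⟩
  simp only [entry_relabelOp]
  exact (Equiv.summable_iff (f := fun i => (entry ρ i i).re) e.symm).2 h.summable_re

theorem trace_relabelOp (e : I ≃ J) (A : Op I) : trace (relabelOp e A) = trace A := by
  simp only [trace_eq_tsum_entry, entry_relabelOp]
  exact e.symm.tsum_eq fun i => entry A i i

theorem IsMixed.tensorOp {ρ : Op I} {σ : Op J} (hρ : IsMixed ρ) (hσ : IsMixed σ) :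
    IsMixed (tensorOp ρ σ) := by
  refine isMixed_iff.2 ⟨isPositive_tensorOp hρ.1 hσ.1, ?_⟩
  refine (hρ.summable_re.mul_of_nonneg hσ.summable_re (entry_self_nonneg hρ.1)
    (entry_self_nonneg hσ.1)).congr fun p => ?_
  rw [entry_tensorOp, ← ofReal_entry_self hρ.1, Complex.re_ofReal_mul, Complex.ofReal_re]

theorem trace_tensorOp {A : Op I} {B : Op J} (hA : Summable fun i => ‖entry A i i‖)
    (hB : Summable fun i => ‖entry B i i‖) : trace (tensorOp A B) = trace A * trace B := by
  simp only [trace_eq_tsum_entry, entry_tensorOp]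
  exact (tsum_mul_tsum_of_summable_norm hA hB).symm

theorem IsMixed.summable_norm {ρ : Op I} (h : IsMixed ρ) : Summable fun i => ‖entry ρ i i‖ :=
  h.hasSum_entry.summable.norm

theorem IsMixed.trace_tensorOp {ρ : Op I} {σ : Op J} (hρ : IsMixed ρ) (hσ : IsMixed σ) :
    trace (QRHL.tensorOp ρ σ) = trace ρ * trace σ :=
  QRHL.trace_tensorOp hρ.summable_norm hσ.summable_norm

/-! ## Partial traces -/

theorem adjoint_slice_ket (i : I) (j : J) :
    ContinuousLinearMap.adjoint (slice j : Ell2 (I × J) →L[ℂ] Ell2 I) (ket i) = ket (i, j) := by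
  classical
  apply lp.ext
  funext p
  rw [← inner_ket_left, ContinuousLinearMap.adjoint_inner_right, ← inner_conj_symm,
    inner_ket_left, slice_apply, ket_apply, ket_apply]
  by_cases h : p = (i, j)
  · simp [h]
  · simp [h, Ne.symm h]

theorem entry_slice_conj (ρ : Op (I × J)) (j : J) (i i' : I) :
    entry (slice j ∘L ρ ∘L
      ContinuousLinearMap.adjoint (slice j : Ell2 (I × J) →L[ℂ] Ell2 I)) i i' =
      entry ρ (i, j) (i', j) := by
  rw [entry, ContinuousLinearMap.comp_apply, ContinuousLinearMap.comp_apply, adjoint_slice_ket]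
  rfl

theorem IsMixed.summable_re_swap {ρ : Op (I × J)} (h : IsMixed ρ) :
    Summable fun p : J × I => (entry ρ (p.2, p.1) (p.2, p.1)).re :=
  (Equiv.prodComm J I).summable_iff (f := fun p => (entry ρ p p).re) |>.2 h.summable_re

theorem IsMixed.slice_conj {ρ : Op (I × J)} (h : IsMixed ρ) (j : J) :
    IsMixed (slice j ∘L ρ ∘L
      ContinuousLinearMap.adjoint (slice j : Ell2 (I × J) →L[ℂ] Ell2 I)) := by
  refine isMixed_iff.2 ⟨h.1.conj_adjoint _, ?_⟩
  simp only [entry_slice_conj]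
  exact h.summable_re_swap.prod_factor j

/-- The `tsum` defining the partial trace converges absolutely in operator norm: each slice has norm
at most its trace, and these traces add up to that of `ρ`. -/
theorem IsMixed.hasSum_traceSnd {ρ : Op (I × J)} (h : IsMixed ρ) :
    HasSum (fun j => slice j ∘L ρ ∘L
      ContinuousLinearMap.adjoint (slice j : Ell2 (I × J) →L[ℂ] Ell2 I)) (traceSnd ρ) := by
  refine (Summable.of_norm_bounded h.summable_re_swap.prod fun j => ?_).hasSum
  refine (h.slice_conj j).norm_le.trans_eq ?_
  rw [(h.slice_conj j).re_trace]
  simp only [entry_slice_conj]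

theorem hasSum_inner_apply {ι : Type*} {f : ι → Op I} {A : Op I} (h : HasSum f A)
    (φ ψ : Ell2 I) : HasSum (fun k => ⟪φ, f k ψ⟫_ℂ) ⟪φ, A ψ⟫_ℂ :=
  (h.mapL (ContinuousLinearMap.apply ℂ (Ell2 I) ψ)).mapL (innerSL ℂ φ)

theorem hasSum_entry_of_hasSum {ι : Type*} {f : ι → Op I} {A : Op I} (h : HasSum f A) (i j : I) :
    HasSum (fun k => entry (f k) i j) (entry A i j) := by
  simpa only [inner_ket_apply_ket] using hasSum_inner_apply h (ket i) (ket j)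

theorem IsMixed.hasSum_entry_traceSnd {ρ : Op (I × J)} (h : IsMixed ρ) (i i' : I) :
    HasSum (fun j => entry ρ (i, j) (i', j)) (entry (traceSnd ρ) i i') := by
  simpa only [entry_slice_conj] using hasSum_entry_of_hasSum h.hasSum_traceSnd i i'

theorem isPositive_of_hasSum {ι : Type*} {f : ι → Op I} {A : Op I} (h : HasSum f A)
    (hf : ∀ k, (f k).IsPositive) : A.IsPositive := by
  rw [← ContinuousLinearMap.nonneg_iff_isPositive]
  exact h.nonneg fun k => (ContinuousLinearMap.nonneg_iff_isPositive _).2 (hf k)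

/-- Fubini for the nonnegative diagonal of `ρ`. -/
theorem IsMixed.hasSum_re_traceSnd {ρ : Op (I × J)} (h : IsMixed ρ) :
    HasSum (fun i => (entry (QRHL.traceSnd ρ) i i).re) (trace ρ).re := by
  have h1 : (fun i => (entry (QRHL.traceSnd ρ) i i).re) =
      fun i => ∑' j, (entry ρ (i, j) (i, j)).re := by
    funext i
    exact ((Complex.hasSum_re (h.hasSum_entry_traceSnd i i)).tsum_eq).symm
  rw [h1, h.re_trace, h.summable_re.tsum_prod]
  exact h.summable_re.prod.hasSum

theorem IsMixed.traceSnd {ρ : Op (I × J)} (h : IsMixed ρ) : IsMixed (traceSnd ρ) :=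
  isMixed_iff.2 ⟨isPositive_of_hasSum h.hasSum_traceSnd fun j => (h.slice_conj j).1,
    h.hasSum_re_traceSnd.summable⟩

theorem IsMixed.trace_traceSnd {ρ : Op (I × J)} (h : IsMixed ρ) :
    trace (QRHL.traceSnd ρ) = trace ρ := by
  rw [← h.traceSnd.ofReal_re_trace, h.traceSnd.re_trace, h.hasSum_re_traceSnd.tsum_eq,
    h.ofReal_re_trace]

theorem IsMixed.traceFst {ρ : Op (I × J)} (h : IsMixed ρ) : IsMixed (traceFst ρ) :=
  (h.relabelOp _).traceSnd

theorem IsMixed.trace_traceFst {ρ : Op (I × J)} (h : IsMixed ρ) :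
    trace (QRHL.traceFst ρ) = trace ρ :=
  (h.relabelOp _).trace_traceSnd.trans (trace_relabelOp _ _)

theorem IsMixed.hasSum_entry_traceFst {ρ : Op (I × J)} (h : IsMixed ρ) (j j' : J) :
    HasSum (fun i => entry ρ (i, j) (i, j')) (entry (QRHL.traceFst ρ) j j') := by
  have h1 := (h.relabelOp (Equiv.prodComm I J)).hasSum_entry_traceSnd j j'
  simp only [entry_relabelOp] at h1
  exact h1

theorem traceSnd_tensorOp {ρ : Op I} {σ : Op J} (hρ : IsMixed ρ) (hσ : IsMixed σ) :
    traceSnd (tensorOp ρ σ) = trace σ • ρ := by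
  refine op_ext_entry fun i i' => ?_
  have h := (hρ.tensorOp hσ).hasSum_entry_traceSnd i i'
  simp only [entry_tensorOp] at h
  rw [entry_smul, mul_comm]
  exact h.unique (hσ.hasSum_entry.mul_left _)

theorem traceFst_tensorOp {ρ : Op I} {σ : Op J} (hρ : IsMixed ρ) (hσ : IsMixed σ) :
    traceFst (tensorOp ρ σ) = trace ρ • σ := by
  rw [traceFst, relabelOp_prodComm_tensorOp, traceSnd_tensorOp hσ hρ]

theorem traceFst_relabelOp_prodCongr (e : I ≃ K) (f : J ≃ L) {ρ : Op (I × J)} (h : IsMixed ρ) :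
    traceFst (relabelOp (e.prodCongr f) ρ) = relabelOp f (traceFst ρ) := by
  refine op_ext_entry fun j j' => ?_
  have h1 := (h.relabelOp (e.prodCongr f)).hasSum_entry_traceFst j j'
  have h2 := h.hasSum_entry_traceFst (f.symm j) (f.symm j')
  simp only [entry_relabelOp] at h1 ⊢
  refine h1.unique ?_
  exact (e.symm.hasSum_iff).2 h2

end Mixed

/-! ## Qubits with real amplitudes -/

/-- The qubit state `cos t |0⟩ + sin t |1⟩`. -/
def qubit (t : ℝ) : Ell2 (Fin 2) := (Real.cos t : ℂ) • ket 0 + (Real.sin t : ℂ) • ket 1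

theorem qubit_apply_zero (t : ℝ) : qubit t 0 = Real.cos t := by
  change (Real.cos t : ℂ) * ket (0 : Fin 2) 0 + (Real.sin t : ℂ) * ket (1 : Fin 2) 0 = _
  simp [ket_apply]

theorem qubit_apply_one (t : ℝ) : qubit t 1 = Real.sin t := by
  change (Real.cos t : ℂ) * ket (0 : Fin 2) 1 + (Real.sin t : ℂ) * ket (1 : Fin 2) 1 = _
  simp [ket_apply]

theorem qubit_ext {φ ψ : Ell2 (Fin 2)} (h0 : φ 0 = ψ 0) (h1 : φ 1 = ψ 1) : φ = ψ := by
  apply lp.ext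
  funext i
  fin_cases i
  · exact h0
  · exact h1

theorem inner_qubit (s t : ℝ) : ⟪qubit s, qubit t⟫_ℂ = Real.cos (s - t) := by
  rw [lp.inner_eq_tsum, tsum_fintype, Fin.sum_univ_two, qubit_apply_zero, qubit_apply_one,
    qubit_apply_zero, qubit_apply_one, Real.cos_sub]
  simp only [RCLike.inner_apply, Complex.conj_ofReal]
  push_cast
  ring

theorem norm_qubit (t : ℝ) : ‖qubit t‖ = 1 := by
  have h : ⟪qubit t, qubit t⟫_ℂ = 1 := by rw [inner_qubit]; simp
  have h2 : ‖qubit t‖ ^ 2 = 1 := by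
    rw [← inner_self_eq_norm_sq (𝕜 := ℂ), h]
    simp
  exact (pow_eq_one_iff_of_nonneg (norm_nonneg _) two_ne_zero).1 h2

/-- The component of `qubit t` orthogonal to `qubit s` is again a real multiple of a single qubit,
the one a quarter turn further. This keeps the measured state inside a one-parameter family. -/
theorem qubit_sub_cos_smul (s t : ℝ) :
    qubit t - (Real.cos (s - t) : ℂ) • qubit s =
      (Real.sin (t - s) : ℂ) • qubit (s + Real.pi / 2) := by
  obtain ⟨d, rfl⟩ : ∃ d, t = s + d := ⟨t - s, by ring⟩
  have e1 : s - (s + d) = -d := by ring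
  have e2 : s + d - s = d := by ring
  rw [e1, e2, Real.cos_neg]
  apply qubit_ext
  · simp only [lp.coeFn_sub, lp.coeFn_smul, Pi.sub_apply, Pi.smul_apply, smul_eq_mul,
      qubit_apply_zero, Real.cos_add_pi_div_two]
    rw [Real.cos_add]
    push_cast
    ring
  · simp only [lp.coeFn_sub, lp.coeFn_smul, Pi.sub_apply, Pi.smul_apply, smul_eq_mul,
      qubit_apply_one, Real.sin_add_pi_div_two]
    rw [Real.sin_add]
    push_cast
    ring

theorem rot_qubit (n : ℕ) (t : ℝ) : rot n (qubit t) = qubit (t + Real.pi / (2 * n)) := by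
  have h : ∀ i, rot n (qubit t) i = (rotMatrix n).mulVec (fun i => qubit t i) i := fun _ => rfl
  apply qubit_ext
  · rw [h, qubit_apply_zero, Real.cos_add]
    simp only [rotMatrix, Matrix.mulVec, dotProduct, Fin.sum_univ_two, qubit_apply_zero,
      qubit_apply_one]
    simp
    ring
  · rw [h, qubit_apply_one, Real.sin_add]
    simp only [rotMatrix, Matrix.mulVec, dotProduct, Fin.sum_univ_two, qubit_apply_zero,
      qubit_apply_one]
    simp
    ring

theorem phi_eq_qubit (n k : ℕ) : phi n k = qubit (k * (Real.pi / (2 * n))) := by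
  induction k with
  | zero => simp [phi, qubit]
  | succ k ih =>
    rw [phi, ih, rot_qubit]
    congr 1
    push_cast
    ring

/-! ## Projections and the two measurements -/

/-- Orthogonality to the generators passes to the closed span. All images needed below lie in the
algebraic span, so no limits have to be taken. -/
theorem projOnto_eq {I : Type*} {S : Set (Ell2 I)} {u v : Ell2 I} (hv : v ∈ Submodule.span ℂ S)
    (h : ∀ s ∈ S, ⟪s, u - v⟫_ℂ = 0) : projOnto S u = v := by
  have : CompleteSpace (Submodule.span ℂ S).topologicalClosure :=
    (Submodule.isClosed_topologicalClosure _).completeSpace_coe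
  refine Submodule.eq_starProjection_of_mem_orthogonal
    (Submodule.le_topologicalClosure _ hv) ?_
  rw [Submodule.orthogonal_closure, Submodule.mem_orthogonal]
  intro w hw
  induction hw using Submodule.span_induction with
  | mem s hs => exact h s hs
  | zero => exact inner_zero_left _
  | add a b _ _ ha hb => rw [inner_add_left, ha, hb, add_zero]
  | smul c a _ ha => rw [inner_smul_left, ha, mul_zero]

theorem measLt_onTrue_ket_of_lt {n : ℕ} {k : ℤ} (h : k < n) :
    (measLt n).onTrue (ket k) = ket k := by
  refine projOnto_eq (Submodule.subset_span ⟨k, h, rfl⟩) fun s _ => ?_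
  rw [sub_self, inner_zero_right]

theorem measLt_onTrue_ket_of_le {n : ℕ} {k : ℤ} (h : (n : ℤ) ≤ k) :
    (measLt n).onTrue (ket k) = 0 := by
  refine projOnto_eq (Submodule.zero_mem _) ?_
  rintro s ⟨i, hi, rfl⟩
  rw [sub_zero, inner_ket_left, ket_apply_ne]
  omega

theorem measLt_onFalse_ket_of_lt {n : ℕ} {k : ℤ} (h : k < n) :
    (measLt n).onFalse (ket k) = 0 := by
  change ket k - (measLt n).onTrue (ket k) = 0
  rw [measLt_onTrue_ket_of_lt h, sub_self]

theorem measLt_onFalse_ket_of_le {n : ℕ} {k : ℤ} (h : (n : ℤ) ≤ k) :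
    (measLt n).onFalse (ket k) = ket k := by
  change ket k - (measLt n).onTrue (ket k) = ket k
  rw [measLt_onTrue_ket_of_le h, sub_zero]

section TensorVec

variable {I J : Type*}

theorem tensorVec_smul_right (c : ℂ) (φ : Ell2 I) (χ : Ell2 J) :
    tensorVec φ (c • χ) = c • tensorVec φ χ := by
  apply lp.ext
  funext p
  exact mul_left_comm _ _ _

theorem tensorVec_sub_right (φ : Ell2 I) (χ χ' : Ell2 J) :
    tensorVec φ (χ - χ') = tensorVec φ χ - tensorVec φ χ' := by
  apply lp.ext
  funext p
  exact mul_sub _ _ _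

theorem summable_norm_inner (φ ψ : Ell2 I) : Summable fun i => ‖⟪φ i, ψ i⟫_ℂ‖ :=
  (lp.summable_inner (𝕜 := ℂ) (G := fun _ : I => ℂ) φ ψ).norm

theorem inner_tensorVec (φ φ' : Ell2 I) (χ χ' : Ell2 J) :
    ⟪tensorVec φ χ, tensorVec φ' χ'⟫_ℂ = ⟪φ, φ'⟫_ℂ * ⟪χ, χ'⟫_ℂ := by
  rw [lp.inner_eq_tsum, lp.inner_eq_tsum, lp.inner_eq_tsum]
  rw [tsum_mul_tsum_of_summable_norm (summable_norm_inner _ _) (summable_norm_inner _ _)]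
  refine tsum_congr fun p => ?_
  simp only [RCLike.inner_apply, tensorVec_apply, map_mul]
  ring

end TensorVec

/-- Generators `|i⟩ ⊗ φ_i` with `i ≠ k` are orthogonal to `|k⟩ ⊗ χ` for every `χ`, so for a definite
counter value the measurement only tests `y` against `φ_k`. -/
theorem measPhi_onTrue_tensorVec (n k : ℕ) (t : ℝ) :
    (measPhi n).onTrue (tensorVec (ket (k : ℤ)) (qubit t)) =
      (Real.cos (k * (Real.pi / (2 * n)) - t) : ℂ) •
        tensorVec (ket (k : ℤ)) (qubit (k * (Real.pi / (2 * n)))) := by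
  refine projOnto_eq (Submodule.smul_mem _ _ (Submodule.subset_span ⟨k, ?_⟩)) ?_
  · simp only [phi_eq_qubit]
  · rintro s ⟨i, rfl⟩
    simp only [phi_eq_qubit]
    rw [inner_sub_right, inner_smul_right, inner_tensorVec, inner_tensorVec, inner_ket_left]
    by_cases h : i = k
    · subst h
      rw [ket_apply_self, inner_qubit, inner_qubit, sub_self, Real.cos_zero]
      simp
    · rw [ket_apply_ne (by exact_mod_cast h)]
      simp

theorem measPhi_onFalse_tensorVec (n k : ℕ) (t : ℝ) :
    (measPhi n).onFalse (tensorVec (ket (k : ℤ)) (qubit t)) =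
      (Real.sin (t - k * (Real.pi / (2 * n))) : ℂ) •
        tensorVec (ket (k : ℤ)) (qubit (k * (Real.pi / (2 * n)) + Real.pi / 2)) := by
  change tensorVec (ket (k : ℤ)) (qubit t) -
    (measPhi n).onTrue (tensorVec (ket (k : ℤ)) (qubit t)) = _
  rw [measPhi_onTrue_tensorVec, ← tensorVec_smul_right, ← tensorVec_sub_right,
    qubit_sub_cos_smul, tensorVec_smul_right]

theorem incr_ket (k : ℤ) : incr (ket k) = ket (k + 1) := relabel_ket _ _

/-! ## Rearranging tensor factors -/

section Rearrange

variable {I J R : Type*}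

/-- The bijection `((i, j), r) ↦ (j, (i, r))`. -/
def prodRotate (I J R : Type*) : (I × J) × R ≃ J × (I × R) :=
  ((Equiv.prodComm I J).prodCongr (Equiv.refl R)).trans (Equiv.prodAssoc J I R)

theorem prodRotate_apply (i : I) (j : J) (r : R) : prodRotate I J R ((i, j), r) = (j, (i, r)) := rfl

theorem relabelOp_prodAssoc_symm_ampLeft (A : Op I) :
    relabelOp (Equiv.prodAssoc I J R).symm (ampLeft A) = ampLeft (ampLeft A) := by
  classical
  refine op_ext_entry fun p q => ?_
  simp only [entry_relabelOp, entry_ampLeft, Equiv.symm_symm, Equiv.prodAssoc_apply, Prod.mk.injEq]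
  split_ifs <;> first | rfl | simp_all

theorem relabelOp_prodRotate_symm_ampLeft (B : Op J) :
    relabelOp (prodRotate I J R).symm (ampLeft B) = ampLeft (ampRight B) := by
  classical
  refine op_ext_entry fun p q => ?_
  obtain ⟨⟨a, b⟩, c⟩ := p
  obtain ⟨⟨a', b'⟩, c'⟩ := q
  simp only [entry_relabelOp, entry_ampLeft, entry_ampRight, Equiv.symm_symm, prodRotate_apply,
    Prod.mk.injEq]
  split_ifs <;> first | rfl | simp_all

theorem relabelOp_prodRotate_symm_tensorOp (A : Op I) (B : Op J) (C : Op R) :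
    relabelOp (prodRotate I J R).symm (tensorOp B (tensorOp A C)) =
      tensorOp (tensorOp A B) C := by
  refine op_ext_entry fun p q => ?_
  simp only [entry_relabelOp, entry_tensorOp, Equiv.symm_symm]
  obtain ⟨⟨a, b⟩, c⟩ := p
  obtain ⟨⟨a', b'⟩, c'⟩ := q
  change entry B b b' * (entry A a a' * entry C c c') = _
  ring

/-- Initializing `y` discards its old value without disturbing the freshly prepared `x`. -/
theorem traceFst_rearrange {A : Op I} {σ : Op (J × R)} (hA : IsMixed A) (hσ : IsMixed σ) :
    traceFst (relabelOp (prodRotate I J R)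
      (relabelOp (Equiv.prodAssoc I J R).symm (tensorOp A σ))) = tensorOp A (traceFst σ) := by
  refine op_ext_entry fun p q => ?_
  have h := (((hA.tensorOp hσ).relabelOp (Equiv.prodAssoc I J R).symm).relabelOp
    (prodRotate I J R)).hasSum_entry_traceFst p q
  simp only [entry_relabelOp] at h
  have h2 : HasSum (fun j => entry (tensorOp A σ) (p.1, (j, p.2)) (q.1, (j, q.2)))
      (entry (tensorOp A (traceFst σ)) p q) := by
    simp only [entry_tensorOp]
    exact (hσ.hasSum_entry_traceFst p.2 q.2).mul_left _
  exact h.unique h2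

end Rearrange

/-! ## Memories -/

section Memories

variable {V : Type*} {T : V → Type*}

/-- Removing `v` from the variables outside `X`, where `Y = X ∪ {v}`. -/
def restrictCompl {X Y : Set V} {v : V} (hv : v ∉ X) (hXY : X ⊆ Y) (m : Assign T Xᶜ) :
    T v × Assign T Yᶜ :=
  (m ⟨v, hv⟩, fun w => m ⟨w, fun h => w.2 (hXY h)⟩)

theorem restrictCompl_bijective [∀ v, Nonempty (T v)] {X Y : Set V} {v : V} (hv : v ∉ X)
    (hXY : X ⊆ Y) (hvY : v ∈ Y) (hY : Y ⊆ insert v X) :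
    Function.Bijective (restrictCompl (T := T) hv hXY) := by
  classical
  constructor
  · intro m m' h
    funext w
    obtain ⟨w, hw⟩ := w
    by_cases hwv : w = v
    · subst hwv
      exact congrArg Prod.fst h
    · exact congrFun (congrArg Prod.snd h) ⟨w, fun h' => (hY h').elim hwv hw⟩
  · rintro ⟨a, r⟩
    refine ⟨fun w => if hw : w.1 = v then cast (congrArg T hw.symm) a else
      r ⟨w.1, fun h' => (hY h').elim hw w.2⟩, ?_⟩
    refine Prod.ext ?_ (funext fun w => ?_)
    · simp [restrictCompl]
    · have : w.1 ≠ v := fun h => w.2 (h ▸ hvY)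
      simp [restrictCompl, this]

/-- Splitting a memory into the values of `x` and `y` and the remaining variables. -/
def pairEquiv {x y : V} (hxy : x ≠ y) {I J : Type*} (ex : T x ≃ I) (ey : T y ≃ J) :
    (I × J) × Assign T ({x, y} : Set V)ᶜ ≃ Memory T :=
  ((split T {x, y}).trans
    (((assignTwo T hxy).trans (ex.prodCongr ey)).prodCongr (Equiv.refl _))).symm

theorem onVars_pair {x y : V} (hxy : x ≠ y) {I J : Type*} (ex : T x ≃ I) (ey : T y ≃ J)
    (C : Op (I × J)) :
    onVars {x, y} (relabelOp ((assignTwo T hxy).trans (ex.prodCongr ey)).symm C) =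
      relabelOp (pairEquiv hxy ex ey) (ampLeft C) := by
  have h := relabelOp_prodCongr_ampLeft
    ((assignTwo T hxy).trans (ex.prodCongr ey)).symm
    (Equiv.refl (Assign T ({x, y} : Set V)ᶜ)) C
  rw [onVars, ← h]
  rfl

variable [∀ v, Nonempty (T v)] {x y : V} (hxy : x ≠ y) {I J : Type*} (ex : T x ≃ I) (ey : T y ≃ J)

/-- The variables other than `x` are `y` and the remaining ones. -/
def complFst : Assign T ({x} : Set V)ᶜ ≃ J × Assign T ({x, y} : Set V)ᶜ :=
  (Equiv.ofBijective (restrictCompl (T := T) (X := {x}) (Y := {x, y}) (v := y)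
    (fun h => hxy (Set.mem_singleton_iff.1 h).symm) (by simp))
    (restrictCompl_bijective _ _ (by simp) (by rw [Set.pair_comm]))).trans
    (ey.prodCongr (Equiv.refl _))

/-- The variables other than `y` are `x` and the remaining ones. -/
def complSnd : Assign T ({y} : Set V)ᶜ ≃ I × Assign T ({x, y} : Set V)ᶜ :=
  (Equiv.ofBijective (restrictCompl (T := T) (X := {y}) (Y := {x, y}) (v := x)
    (fun h => hxy (Set.mem_singleton_iff.1 h)) (by simp))
    (restrictCompl_bijective _ _ (by simp) subset_rfl)).trans
    (ex.prodCongr (Equiv.refl _))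

/-- Splitting off `x` and then `y` reads the same coordinates as splitting off the pair, so this is
definitional. It places operators on `{x}`, `{y}` and `{x, y}` in one common tensor decomposition.
-/
theorem pairEquiv_symm_eq_fst : (pairEquiv hxy ex ey).symm = (split T {x}).trans
    ((((assignOne T x).trans ex).prodCongr (complFst hxy ey)).trans
      (Equiv.prodAssoc _ _ _).symm) := by
  ext1 m
  rfl

theorem pairEquiv_symm_eq_snd : (pairEquiv hxy ex ey).symm = (split T {y}).trans
    ((((assignOne T y).trans ey).prodCongr (complSnd hxy ex)).trans
      (prodRotate _ _ _).symm) := by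
  ext1 m
  rfl

theorem relabelOp_split_fst_symm (X : Op (Assign T {x} × Assign T {x}ᶜ)) :
    relabelOp (split T {x}).symm X = relabelOp (pairEquiv hxy ex ey)
      (relabelOp (Equiv.prodAssoc _ _ _).symm
        (relabelOp (((assignOne T x).trans ex).prodCongr (complFst hxy ey)) X)) := by
  rw [← (pairEquiv hxy ex ey).symm_symm, pairEquiv_symm_eq_fst]
  simp only [relabelOp_trans]
  congr 1
  ext1 m
  simp

theorem relabelOp_split_snd_symm (X : Op (Assign T {y} × Assign T {y}ᶜ)) :
    relabelOp (split T {y}).symm X = relabelOp (pairEquiv hxy ex ey)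
      (relabelOp (prodRotate _ _ _).symm
        (relabelOp (((assignOne T y).trans ey).prodCongr (complSnd hxy ex)) X)) := by
  rw [← (pairEquiv hxy ex ey).symm_symm, pairEquiv_symm_eq_snd]
  simp only [relabelOp_trans]
  congr 1
  refine Equiv.ext fun ⟨a, m⟩ => ?_
  simp

theorem onVars_fst (A : Op I) :
    onVars {x} (relabelOp ((assignOne T x).trans ex).symm A) =
      relabelOp (pairEquiv hxy ex ey) (ampLeft (ampLeft A)) := by
  rw [onVars, relabelOp_split_fst_symm hxy ex ey, relabelOp_prodCongr_ampLeft,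
    relabelOp_symm_self, relabelOp_prodAssoc_symm_ampLeft]

theorem onVars_snd (B : Op J) :
    onVars {y} (relabelOp ((assignOne T y).trans ey).symm B) =
      relabelOp (pairEquiv hxy ex ey) (ampLeft (ampRight B)) := by
  rw [onVars, relabelOp_split_snd_symm hxy ex ey, relabelOp_prodCongr_ampLeft,
    relabelOp_symm_self, relabelOp_prodRotate_symm_ampLeft]

end Memories

/-! ## States of the loop -/

section States

variable {V : Type*} {T : V → Type*} {x y : V} (hxy : x ≠ y)
  (ex : T x ≃ ℤ) (ey : T y ≃ Fin 2)

/-- The state `|k⟩⟨k| ⊗ ω ⊗ τ` of `x`, `y` and the remaining variables. -/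
def loopState (τ : Op (Assign T ({x, y} : Set V)ᶜ)) (k : ℤ) (ω : Op (Fin 2)) : Op (Memory T) :=
  relabelOp (pairEquiv hxy ex ey) (tensorOp (tensorOp (proj (ket k)) ω) τ)

variable (τ : Op (Assign T ({x, y} : Set V)ᶜ))

theorem conj_onVars_pair_loopState (C : Op (ℤ × Fin 2)) (k : ℤ) (ψ χ : Ell2 (Fin 2)) (c : ℂ)
    (h : C (tensorVec (ket k) ψ) = c • tensorVec (ket k) χ) :
    conj (onVars {x, y} (relabelOp ((assignTwo T hxy).trans (ex.prodCongr ey)).symm C))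
      (loopState hxy ex ey τ k (proj ψ)) =
        (c * star c) • loopState hxy ex ey τ k (proj χ) := by
  rw [onVars_pair, loopState, conj_relabelOp, conj_ampLeft_tensorOp, tensorOp_proj,
    conj_proj, h, proj_smul, tensorOp_smul_left, relabelOp_smul, ← tensorOp_proj]
  rfl

theorem loopState_add (k : ℤ) (ω ω' : Op (Fin 2)) :
    loopState hxy ex ey τ k (ω + ω') =
      loopState hxy ex ey τ k ω + loopState hxy ex ey τ k ω' := by
  rw [loopState, tensorOp_add_right, tensorOp_add_left, relabelOp_add]
  rfl

theorem loopState_smul (k : ℤ) (c : ℂ) (ω : Op (Fin 2)) :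
    loopState hxy ex ey τ k (c • ω) = c • loopState hxy ex ey τ k ω := by
  rw [loopState, tensorOp_smul_right, tensorOp_smul_left, relabelOp_smul]
  rfl

variable [∀ v, Nonempty (T v)]

/-- Both old values are traced out, so `τ` is the marginal of `ρ` on the remaining variables and all
correlations with `x` and `y` are lost. -/
theorem exists_denot_init {ρ : Op (Memory T)} (hρ : IsMixed ρ) :
    ∃ τ : Op (Assign T ({x, y} : Set V)ᶜ), IsMixed τ ∧ trace τ = trace ρ ∧
      denot (initKet ey 0) (denot (initKet ex 0) ρ) = loopState hxy ex ey τ 0 (proj (ket 0)) := by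
  have hσ : IsMixed (traceFst (relabelOp (split T {x}) ρ)) := (hρ.relabelOp _).traceFst
  set σ := traceFst (relabelOp (split T {x}) ρ) with hσd
  have hσ' : IsMixed (relabelOp (complFst hxy ey) σ) := hσ.relabelOp _
  refine ⟨traceFst (relabelOp (complFst hxy ey) σ), hσ'.traceFst, ?_, ?_⟩
  · rw [hσ'.trace_traceFst, trace_relabelOp, hσd, (hρ.relabelOp _).trace_traceFst,
      trace_relabelOp]
  have h1 : denot (initKet ex 0) ρ = relabelOp (pairEquiv hxy ex ey)
      (relabelOp (Equiv.prodAssoc _ _ _).symm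
        (tensorOp (proj (ket 0)) (relabelOp (complFst hxy ey) σ))) := by
    rw [initKet, denot, relabelOp_split_fst_symm hxy ex ey, relabelOp_prodCongr_tensorOp,
      ← relabelOp_proj, relabelOp_symm_self]
  have hX := ((isMixed_proj (ket (0 : ℤ))).tensorOp hσ').relabelOp (Equiv.prodAssoc _ _ _).symm
  rw [h1]
  set X := relabelOp (Equiv.prodAssoc ℤ (Fin 2) (Assign T ({x, y} : Set V)ᶜ)).symm
    (tensorOp (proj (ket 0)) (relabelOp (complFst hxy ey) σ)) with hXd
  have h2 : relabelOp (split T {y}) (relabelOp (pairEquiv hxy ex ey) X) =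
      relabelOp (((assignOne T y).trans ey).symm.prodCongr (complSnd hxy ex).symm)
        (relabelOp (prodRotate _ _ _) X) := by
    -- The rearrangement is inverted by applying it to the preimage of `X`.
    have h3 := relabelOp_split_snd_symm hxy ex ey
      (relabelOp (((assignOne T y).trans ey).prodCongr (complSnd hxy ex)).symm
        (relabelOp (prodRotate _ _ _) X))
    rw [relabelOp_symm_self, relabelOp_self_symm] at h3
    rw [← h3]
    exact relabelOp_symm_self _ _
  rw [initKet, denot, h2, traceFst_relabelOp_prodCongr _ _ (hX.relabelOp _), hXd,
    traceFst_rearrange (isMixed_proj _) hσ', relabelOp_split_snd_symm hxy ex ey,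
    relabelOp_prodCongr_tensorOp, relabelOp_symm_self, ← relabelOp_proj, relabelOp_symm_self,
    relabelOp_prodRotate_symm_tensorOp]
  rfl

/-- Here the counter joins the environment of `y`; marginals on `y` and the EQUAL expectation are
read off from this form. -/
theorem loopState_eq_split (k : ℤ) (ω : Op (Fin 2)) :
    loopState hxy ex ey τ k ω = relabelOp (split T {y}).symm
      (tensorOp (relabelOp ((assignOne T y).trans ey).symm ω)
        (relabelOp (complSnd hxy ex).symm (tensorOp (proj (ket k)) τ))) := by
  rw [relabelOp_split_snd_symm hxy ex ey, relabelOp_prodCongr_tensorOp, relabelOp_symm_self,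
    relabelOp_symm_self, relabelOp_prodRotate_symm_tensorOp]
  rfl

theorem conj_onVars_fst_loopState (A : Op ℤ) (k : ℤ) (ω : Op (Fin 2)) :
    conj (onVars {x} (relabelOp ((assignOne T x).trans ex).symm A)) (loopState hxy ex ey τ k ω) =
      relabelOp (pairEquiv hxy ex ey) (tensorOp (tensorOp (proj (A (ket k))) ω) τ) := by
  rw [onVars_fst hxy ex ey, loopState, conj_relabelOp, conj_ampLeft_tensorOp,
    conj_ampLeft_tensorOp, conj_proj]

theorem conj_onVars_snd_loopState (B : Op (Fin 2)) (k : ℤ) (ψ : Ell2 (Fin 2)) :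
    conj (onVars {y} (relabelOp ((assignOne T y).trans ey).symm B))
      (loopState hxy ex ey τ k (proj ψ)) = loopState hxy ex ey τ k (proj (B ψ)) := by
  rw [onVars_snd hxy ex ey, loopState, conj_relabelOp, conj_ampLeft_tensorOp, tensorOp_proj,
    conj_proj, ampRight_tensorVec, ← tensorOp_proj]
  rfl

theorem denot_applyIncr_loopState (k : ℤ) (ω : Op (Fin 2)) :
    denot (applyIncr ex) (loopState hxy ex ey τ k ω) = loopState hxy ex ey τ (k + 1) ω := by
  have h := conj_onVars_fst_loopState hxy ex ey τ incr.toContinuousLinearMap k ω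
  have h2 : incr.toContinuousLinearMap (ket k) = ket (k + 1) := incr_ket k
  rw [h2] at h
  exact h

theorem denot_rot_loopState (n : ℕ) (k : ℤ) (t : ℝ) :
    denot (.apply {y} (relabelIso ((assignOne T y).trans ey).symm (rot n)))
      (loopState hxy ex ey τ k (proj (qubit t))) =
        loopState hxy ex ey τ k (proj (qubit (t + Real.pi / (2 * n)))) := by
  have h := conj_onVars_snd_loopState hxy ex ey τ (rot n).toContinuousLinearMap k (qubit t)
  have h2 : (rot n).toContinuousLinearMap (qubit t) = qubit (t + Real.pi / (2 * n)) :=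
    rot_qubit n t
  rw [h2] at h
  exact h

/-- If the body of the loop advances a family of states, only the `n`-th term of the sum that
interprets the loop is nonzero. -/
theorem denot_while_loopState (n : ℕ) (body : Prog T) (ω : ℕ → Op (Fin 2))
    (hbody : ∀ k : ℕ, denot body (loopState hxy ex ey τ k (ω k)) =
      loopState hxy ex ey τ (k + 1 : ℕ) (ω (k + 1))) (hzero : denot body 0 = 0) :
    denot (.while {x} ((measLt n).relabel ((assignOne T x).trans ex).symm) body)
      (loopState hxy ex ey τ 0 (ω 0)) = loopState hxy ex ey τ n (ω n) := by
  have hT := fun k (ω : Op (Fin 2)) =>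
    conj_onVars_fst_loopState hxy ex ey τ (measLt n).onTrue k ω
  have hF := fun k (ω : Op (Fin 2)) =>
    conj_onVars_fst_loopState hxy ex ey τ (measLt n).onFalse k ω
  have hvanish : ∀ ω : Op (Fin 2), relabelOp (pairEquiv hxy ex ey)
      (tensorOp (tensorOp (proj (0 : Ell2 ℤ)) ω) τ) = 0 := fun ω => by
    refine op_ext_entry fun i j => ?_
    simp only [entry_relabelOp, entry_tensorOp, entry_proj]
    simp [entry]
  rw [denot]
  set F : Op (Memory T) → Op (Memory T) := fun σ => denot body (conj (onVars {x}
    ((measLt n).relabel ((assignOne T x).trans ex).symm).onTrue) σ) with hFd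
  -- The guard holds at the counter values `0, …, n - 1`, so the first `n` passes leave the states
  -- unprojected.
  have hstep : ∀ k : ℕ, k ≤ n → F^[k] (loopState hxy ex ey τ 0 (ω 0)) =
      loopState hxy ex ey τ k (ω k) := by
    intro k
    induction k with
    | zero => intro _; rfl
    | succ k ih =>
      intro hk
      rw [Function.iterate_succ_apply', ih (by omega), hFd, ← hbody k]
      refine congrArg (denot body) ((hT k (ω k)).trans ?_)
      rw [measLt_onTrue_ket_of_lt (by omega)]
      rfl
  have hF0 : F 0 = 0 := by rw [hFd]; simp only [conj_zero, hzero]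
  -- At counter value `n` the guard projects to zero, and `hzero` keeps every later iterate at zero.
  have hafter : ∀ k : ℕ, F^[n + 1 + k] (loopState hxy ex ey τ 0 (ω 0)) = 0 := by
    intro k
    induction k with
    | zero =>
      rw [add_zero, Function.iterate_succ_apply', hstep n le_rfl, hFd]
      refine (congrArg (denot body) ((hT n (ω n)).trans ?_)).trans hzero
      rw [measLt_onTrue_ket_of_le le_rfl, hvanish]
    | succ k ih => rw [← add_assoc, Function.iterate_succ_apply', ih, hF0]
  -- Terms with `k < n` are killed by the exit projector, those with `k > n` by `hafter`.
  rw [tsum_eq_single n]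
  · rw [hstep n le_rfl]
    refine (hF n (ω n)).trans ?_
    rw [measLt_onFalse_ket_of_le le_rfl]
    rfl
  · intro k hk
    rcases lt_or_gt_of_ne hk with h | h
    · rw [hstep k h.le]
      refine (hF k (ω k)).trans ?_
      rw [measLt_onFalse_ket_of_lt (by omega), hvanish]
    · obtain ⟨m, rfl⟩ := Nat.exists_eq_add_of_lt h
      rw [show n + m + 1 = n + 1 + m by ring, hafter, conj_zero]

end States

/-! ## The success probability -/

theorem zenoEps_nonneg (n : ℕ) : 0 ≤ zenoEps n := sq_nonneg _

theorem zenoEps_le_one (n : ℕ) : zenoEps n ≤ 1 := Real.cos_sq_le_one _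

/-- The probability that the measured qubit is in the state `φ_k` after `k` measurements. -/
def zenoProb (n : ℕ) : ℕ → ℝ
  | 0 => 1
  | k + 1 => zenoProb n k * zenoEps n + (1 - zenoProb n k) * (1 - zenoEps n)

theorem zenoProb_mem (n k : ℕ) : 0 ≤ zenoProb n k ∧ zenoProb n k ≤ 1 := by
  have h0 := zenoEps_nonneg n
  have h1 := zenoEps_le_one n
  induction k with
  | zero => simp [zenoProb]
  | succ k ih =>
    rw [zenoProb]
    -- The four products supplied are nonnegative and sum to one; the new weight is the sum of two
    -- of them.
    constructor <;> nlinarith [mul_nonneg ih.1 h0, mul_nonneg (sub_nonneg.2 ih.2) (sub_nonneg.2 h1),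
      mul_nonneg ih.1 (sub_nonneg.2 h1), mul_nonneg (sub_nonneg.2 ih.2) h0]

/-- The bound counts only the history in which every measurement succeeds; returns from the
orthogonal state add a nonnegative amount. -/
theorem zenoEps_pow_le_zenoProb (n k : ℕ) : zenoEps n ^ k ≤ zenoProb n k := by
  induction k with
  | zero => simp [zenoProb]
  | succ k ih =>
    rw [pow_succ, zenoProb]
    have h := mul_nonneg (sub_nonneg.2 (zenoProb_mem n k).2) (sub_nonneg.2 (zenoEps_le_one n))
    have h2 := mul_le_mul_of_nonneg_right ih (zenoEps_nonneg n)
    linarith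

/-- Bernoulli's inequality with `sin² θ ≤ θ²` gives `(1 - sin² θ)^n ≥ 1 - n θ² = 1 - π²/(4n)`. -/
theorem tendsto_zenoEps_pow :
    Filter.Tendsto (fun n : ℕ => zenoEps n ^ n) Filter.atTop (nhds 1) := by
  have hlow : Filter.Tendsto (fun n : ℕ => 1 - Real.pi ^ 2 / 4 * (1 / (n : ℝ))) Filter.atTop
      (nhds 1) := by
    simpa using (tendsto_const_nhds (x := (1 : ℝ))).sub
      (tendsto_one_div_atTop_nhds_zero_nat.const_mul (Real.pi ^ 2 / 4))
  refine tendsto_of_tendsto_of_tendsto_of_le_of_le' hlow tendsto_const_nhds ?_ ?_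
  · filter_upwards [Filter.eventually_ge_atTop 1] with n hn
    have hn' : (0 : ℝ) < n := by exact_mod_cast hn
    set θ := Real.pi / (2 * n) with hθ
    have h1 : zenoEps n = 1 + -Real.sin θ ^ 2 := by
      rw [zenoEps, Real.cos_sq']
      ring
    have h2 := one_add_mul_le_pow (a := -Real.sin θ ^ 2)
      (by linarith [Real.sin_sq_le_one θ]) n
    rw [← h1] at h2
    have h3 : n * Real.sin θ ^ 2 ≤ n * θ ^ 2 :=
      mul_le_mul_of_nonneg_left Real.sin_sq_le_sq hn'.le
    have h4 : n * θ ^ 2 = Real.pi ^ 2 / 4 * (1 / (n : ℝ)) := by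
      rw [hθ]
      field_simp
      ring
    linarith
  · exact Filter.Eventually.of_forall fun n => pow_le_one₀ (zenoEps_nonneg n) (zenoEps_le_one n)

/-! ## Denotations of the two programs -/

/-- The mixture `a |φ⟩⟨φ| + (1 - a) |χ⟩⟨χ|`. -/
def mixture {I : Type*} (a : ℝ) (φ χ : Ell2 I) : Op I :=
  (a : ℂ) • proj φ + ((1 - a : ℝ) : ℂ) • proj χ

theorem relabelOp_mixture {I J : Type*} (e : I ≃ J) (a : ℝ) (φ χ : Ell2 I) :
    relabelOp e (mixture a φ χ) = mixture a (relabel e φ) (relabel e χ) := by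
  simp only [mixture, relabelOp_add, relabelOp_smul, relabelOp_proj]

theorem isMixed_mixture {I : Type*} {a : ℝ} (h0 : 0 ≤ a) (h1 : a ≤ 1) (φ χ : Ell2 I) :
    IsMixed (mixture a φ χ) :=
  ((isMixed_proj φ).smul h0).add ((isMixed_proj χ).smul (sub_nonneg.2 h1))

theorem trace_mixture {I : Type*} {a : ℝ} (h0 : 0 ≤ a) (h1 : a ≤ 1) {φ χ : Ell2 I}
    (hφ : ‖φ‖ = 1) (hχ : ‖χ‖ = 1) : trace (mixture a φ χ) = 1 := by
  rw [mixture, trace_add ((isMixed_proj φ).smul h0) ((isMixed_proj χ).smul (sub_nonneg.2 h1)),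
    trace_smul, trace_smul, trace_proj, trace_proj, hφ, hχ]
  push_cast
  ring

theorem norm_proj_le {I : Type*} {φ : Ell2 I} (hφ : ‖φ‖ = 1) : ‖proj φ‖ ≤ 1 := by
  refine (isMixed_proj φ).norm_le.trans_eq ?_
  rw [trace_proj, hφ]
  simp

/-- The difference equals `(1 - a)(|φ⟩⟨φ| - |χ⟩⟨χ|)`, and each projection has norm at most one. -/
theorem norm_proj_sub_mixture_le {I : Type*} {a : ℝ} (h1 : a ≤ 1) {φ χ : Ell2 I}
    (hφ : ‖φ‖ = 1) (hχ : ‖χ‖ = 1) : ‖proj φ - mixture a φ χ‖ ≤ (1 - a) * 2 := by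
  have h : proj φ - mixture a φ χ = ((1 - a : ℝ) : ℂ) • (proj φ - proj χ) := by
    rw [mixture]
    push_cast
    module
  rw [h, norm_smul, Complex.norm_real, Real.norm_of_nonneg (sub_nonneg.2 h1)]
  refine mul_le_mul_of_nonneg_left ?_ (sub_nonneg.2 h1)
  linarith [norm_sub_le (proj φ) (proj χ), norm_proj_le hφ, norm_proj_le hχ]

section Programs

variable {V : Type*} {T : V → Type*} [∀ v, Nonempty (T v)] {x y : V} (hxy : x ≠ y)
  (ex : T x ≃ ℤ) (ey : T y ≃ Fin 2)

theorem denot_rotateBody (τ : Op (Assign T ({x, y} : Set V)ᶜ)) (n k : ℕ) :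
    denot (.seq (applyIncr ex) (.apply {y} (relabelIso ((assignOne T y).trans ey).symm (rot n))))
      (loopState hxy ex ey τ k (proj (qubit (k * (Real.pi / (2 * n)))))) =
    loopState hxy ex ey τ (k + 1 : ℕ) (proj (qubit ((k + 1 : ℕ) * (Real.pi / (2 * n))))) := by
  rw [denot, denot_applyIncr_loopState, denot_rot_loopState]
  push_cast
  congr 3
  ring

/-- Both branches are `skip`, so the outcome is forgotten and `y` becomes diagonal in the basis of
`φ_{k+1}` and its orthogonal. The squared overlaps of the old basis with the new one are `cos² θ`
and `sin² θ`. -/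
theorem denot_measureBody (τ : Op (Assign T ({x, y} : Set V)ᶜ)) (n k : ℕ) :
    denot (.seq (applyIncr ex)
      (.ite {x, y} ((measPhi n).relabel ((assignTwo T hxy).trans (Equiv.prodCongr ex ey)).symm)
        .skip .skip))
      (loopState hxy ex ey τ k (mixture (zenoProb n k) (qubit (k * (Real.pi / (2 * n))))
        (qubit (k * (Real.pi / (2 * n)) + Real.pi / 2)))) =
    loopState hxy ex ey τ (k + 1 : ℕ) (mixture (zenoProb n (k + 1))
      (qubit ((k + 1 : ℕ) * (Real.pi / (2 * n))))
      (qubit ((k + 1 : ℕ) * (Real.pi / (2 * n)) + Real.pi / 2))) := by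
  -- The counter is incremented before the measurement, hence the index `k + 1`.
  have hT := fun t => conj_onVars_pair_loopState hxy ex ey τ (measPhi n).onTrue _ _ _ _
    (measPhi_onTrue_tensorVec n (k + 1) t)
  have hF := fun t => conj_onVars_pair_loopState hxy ex ey τ (measPhi n).onFalse _ _ _ _
    (measPhi_onFalse_tensorVec n (k + 1) t)
  have hT' : ∀ t, conj (onVars {x, y} ((measPhi n).relabel
      ((assignTwo T hxy).trans (Equiv.prodCongr ex ey)).symm).onTrue) _ = _ := hT
  have hF' : ∀ t, conj (onVars {x, y} ((measPhi n).relabel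
      ((assignTwo T hxy).trans (Equiv.prodCongr ex ey)).symm).onFalse) _ = _ := hF
  rw [denot, denot_applyIncr_loopState, denot, denot, denot]
  have hcast : ((k : ℤ) + 1) = ((k + 1 : ℕ) : ℤ) := by push_cast; rfl
  rw [hcast]
  simp only [mixture, loopState_add, loopState_smul, conj_add, conj_smul, hT', hF']
  set θ := Real.pi / (2 * n) with hθ
  -- The four angle differences between the old and the new basis; up to sign their amplitudes are
  -- `cos θ` or `sin θ`.
  have e1 : ((k + 1 : ℕ) : ℝ) * θ - k * θ = θ := by push_cast; ring
  have e2 : ((k + 1 : ℕ) : ℝ) * θ - (k * θ + Real.pi / 2) = -(Real.pi / 2 - θ) := by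
    push_cast; ring
  have e3 : (k : ℝ) * θ - (k + 1 : ℕ) * θ = -θ := by push_cast; ring
  have e4 : (k : ℝ) * θ + Real.pi / 2 - (k + 1 : ℕ) * θ = Real.pi / 2 - θ := by
    push_cast; ring
  rw [e1, e2, e3, e4, Real.cos_neg, Real.sin_neg, Real.cos_pi_div_two_sub,
    Real.sin_pi_div_two_sub]
  have hs : (Real.sin θ : ℂ) ^ 2 = 1 - (zenoEps n : ℂ) := by
    have := Real.sin_sq θ
    rw [zenoEps, ← hθ]
    exact_mod_cast this
  have hc : (Real.cos θ : ℂ) ^ 2 = (zenoEps n : ℂ) := by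
    rw [zenoEps, ← hθ]
    push_cast
    rfl
  simp only [Complex.star_def, Complex.ofReal_neg, map_neg, Complex.conj_ofReal, neg_sq,
    ← sq, hs, hc, zenoProb, smul_smul]
  push_cast
  module

/-- The witness `κ` is `|n⟩⟨n| ⊗ τ`, the final counter together with the untouched variables, so `y`
ends uncorrelated with everything else. -/
theorem denot_zenoLoop {ρ : Op (Memory T)} (hρ : IsMixed ρ) (n : ℕ) (body : Prog T)
    (ω : ℕ → Op (Fin 2)) (hω : ω 0 = proj (ket 0))
    (hbody : ∀ (τ : Op (Assign T ({x, y} : Set V)ᶜ)) (k : ℕ),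
      denot body (loopState hxy ex ey τ k (ω k)) =
        loopState hxy ex ey τ (k + 1 : ℕ) (ω (k + 1))) (hzero : denot body 0 = 0) :
    ∃ κ : Op (Assign T ({y} : Set V)ᶜ), IsMixed κ ∧ trace κ = trace ρ ∧
      denot (zenoLoop ex ey n body) ρ = relabelOp (split T {y}).symm
        (tensorOp (relabelOp ((assignOne T y).trans ey).symm (ω n)) κ) := by
  obtain ⟨τ, hτ, htr, hinit⟩ := exists_denot_init hxy ex ey hρ
  refine ⟨_, ((isMixed_proj (ket (n : ℤ))).tensorOp hτ).relabelOp (complSnd hxy ex).symm, ?_, ?_⟩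
  · rw [trace_relabelOp, (isMixed_proj _).trace_tensorOp hτ, trace_proj, norm_ket, htr]
    simp
  · rw [← loopState_eq_split, zenoLoop, denot, denot, hinit, ← hω]
    exact denot_while_loopState hxy ex ey τ n body ω (hbody τ) hzero

theorem qubit_zero : qubit 0 = ket 0 := by
  simp [qubit]

theorem denot_zenoMeasure {ρ : Op (Memory T)} (hρ : IsMixed ρ) (n : ℕ) :
    ∃ κ : Op (Assign T ({y} : Set V)ᶜ), IsMixed κ ∧ trace κ = trace ρ ∧
      denot (zenoMeasure hxy ex ey n) ρ = relabelOp (split T {y}).symm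
        (tensorOp (mixture (zenoProb n n)
          (relabel ((assignOne T y).trans ey).symm (qubit (n * (Real.pi / (2 * n)))))
          (relabel ((assignOne T y).trans ey).symm
            (qubit (n * (Real.pi / (2 * n)) + Real.pi / 2)))) κ) := by
  rw [← relabelOp_mixture]
  refine denot_zenoLoop hxy ex ey hρ n _ (fun k => mixture (zenoProb n k)
    (qubit (k * (Real.pi / (2 * n)))) (qubit (k * (Real.pi / (2 * n)) + Real.pi / 2))) ?_
    (fun τ k => denot_measureBody hxy ex ey τ n k) ?_
  · simp [qubit_zero, mixture, zenoProb]
  · simp only [applyIncr, denot, conj_zero, add_zero]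

end Programs

theorem denot_zenoRotate {V : Type*} {T : V → Type*} [∀ v, Nonempty (T v)] {x y : V}
    (hxy : x ≠ y) (ex : T x ≃ ℤ) (ey : T y ≃ Fin 2) {ρ : Op (Memory T)} (hρ : IsMixed ρ) (n : ℕ) :
    ∃ κ : Op (Assign T ({y} : Set V)ᶜ), IsMixed κ ∧ trace κ = trace ρ ∧
      denot (zenoRotate ex ey n) ρ = relabelOp (split T {y}).symm
        (tensorOp (proj (relabel ((assignOne T y).trans ey).symm
          (qubit (n * (Real.pi / (2 * n)))))) κ) := by
  rw [← relabelOp_proj]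
  refine denot_zenoLoop hxy ex ey hρ n _ (fun k => proj (qubit (k * (Real.pi / (2 * n))))) ?_
    (fun τ k => denot_rotateBody hxy ex ey τ n k) ?_
  · simp [qubit_zero]
  · simp only [applyIncr, denot, conj_zero]

/-! ## The expectation `EQUAL` -/

section Equal

variable {I : Type*}

theorem trace_comp_proj (A : Op I) (ψ : Ell2 I) : trace (A ∘L proj ψ) = ⟪ψ, A ψ⟫_ℂ := by
  rw [trace_eq_tsum_entry, lp.inner_eq_tsum]
  refine tsum_congr fun i => ?_
  rw [entry, ContinuousLinearMap.comp_apply, proj_apply, map_smul, ← inner_conj_symm,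
    inner_ket_left, RCLike.inner_apply]
  exact mul_comm _ _

/-- Products such as `equalOp I ∘L proj ψ` need not be positive, so `trace_add` does not apply to
them; on a finite index set no summability is needed. -/
theorem trace_add_of_finite [Finite I] (A B : Op I) : trace (A + B) = trace A + trace B := by
  have := Fintype.ofFinite I
  simp only [trace_eq_tsum_entry, tsum_fintype, entry_add, Finset.sum_add_distrib]

theorem isPositive_equalOp (I : Type*) : (equalOp I).IsPositive :=
  .of_isStarProjection (isStarProjection_projOnto _)

theorem equalOp_tensorVec_self (φ : Ell2 I) : equalOp I (tensorVec φ φ) = tensorVec φ φ := by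
  refine projOnto_eq (Submodule.subset_span (relabel_prodComm_tensorVec φ φ)) fun s _ => ?_
  rw [sub_self, inner_zero_right]

/-- The term `φ ⊗ φ` is symmetric and contributes its full weight `a`; the term `φ ⊗ χ` contributes
a nonnegative amount, which is dropped. -/
theorem le_re_trace_equalOp [Finite I] {a : ℝ} (h1 : a ≤ 1) {φ χ : Ell2 I} (hφ : ‖φ‖ = 1) :
    a ≤ (trace (equalOp I ∘L tensorOp (proj φ) (mixture a φ χ))).re := by
  have h : equalOp I ∘L tensorOp (proj φ) (mixture a φ χ) =
      (a : ℂ) • (equalOp I ∘L proj (tensorVec φ φ)) +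
        ((1 - a : ℝ) : ℂ) • (equalOp I ∘L proj (tensorVec φ χ)) := by
    rw [mixture, tensorOp_add_right, tensorOp_smul_right, tensorOp_smul_right, tensorOp_proj,
      tensorOp_proj, ContinuousLinearMap.comp_add, ContinuousLinearMap.comp_smul,
      ContinuousLinearMap.comp_smul]
  have hφφ : ⟪φ, φ⟫_ℂ = 1 := by rw [inner_self_eq_norm_sq_to_K, hφ]; simp
  rw [h, trace_add_of_finite, trace_smul, trace_smul, trace_comp_proj, trace_comp_proj,
    equalOp_tensorVec_self, inner_tensorVec, hφφ, Complex.add_re, Complex.re_ofReal_mul,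
    Complex.re_ofReal_mul]
  have h2 := mul_nonneg (sub_nonneg.2 h1)
    (re_inner_self_nonneg (isPositive_equalOp I) (tensorVec φ χ))
  simpa using h2

variable {V : Type*} {T : V → Type*}

theorem isPositive_equalOn (X : Set V) : (equalOn (T := T) X).IsPositive :=
  isPositive_relabelOp _ (isPositive_ampLeft (isPositive_equalOp _))

theorem tensorOp_split_symm (X : Set V) (ω₁ ω₂ : Op (Assign T X)) (κ₁ κ₂ : Op (Assign T Xᶜ)) :
    tensorOp (relabelOp (split T X).symm (tensorOp ω₁ κ₁))
      (relabelOp (split T X).symm (tensorOp ω₂ κ₂)) =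
    relabelOp (splitPair T X).symm (tensorOp (tensorOp ω₁ ω₂) (tensorOp κ₁ κ₂)) := by
  refine op_ext_entry fun p q => ?_
  simp only [entry_relabelOp, entry_tensorOp, Equiv.symm_symm]
  exact mul_mul_mul_comm _ _ _ _

/-- EQUAL acts only on the two copies of `X`, so the environments contribute just their traces. -/
theorem trace_equalOn_comp {X : Set V} [Finite (Assign T X)] {ω₁ ω₂ : Op (Assign T X)}
    {κ₁ κ₂ : Op (Assign T Xᶜ)} (h₁ : IsMixed κ₁) (h₂ : IsMixed κ₂) :
    trace (equalOn X ∘L tensorOp (relabelOp (split T X).symm (tensorOp ω₁ κ₁))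
      (relabelOp (split T X).symm (tensorOp ω₂ κ₂))) =
    trace (equalOp (Assign T X) ∘L tensorOp ω₁ ω₂) * (trace κ₁ * trace κ₂) := by
  rw [tensorOp_split_symm, equalOn, ← relabelOp_comp, ampLeft_comp_tensorOp, trace_relabelOp,
    trace_tensorOp Summable.of_finite (h₁.tensorOp h₂).summable_norm, h₁.trace_tensorOp h₂]

theorem marginal_split_symm {X : Set V} {ω : Op (Assign T X)} {κ : Op (Assign T Xᶜ)}
    (hω : IsMixed ω) (hκ : IsMixed κ) :
    marginal X (relabelOp (split T X).symm (tensorOp ω κ)) = trace κ • ω := by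
  rw [marginal, relabelOp_symm_self, traceSnd_tensorOp hω hκ]

end Equal

/-! ## A product coupling -/

section Coupling

variable {I J : Type*}

theorem isSeparable_tensorOp {σ : Op I} {τ : Op J} (hσ : IsMixed σ) (hτ : IsMixed τ) :
    IsSeparable (tensorOp σ τ) :=
  ⟨hσ.tensorOp hτ, Unit, fun _ => σ, fun _ => τ, fun _ => hσ, fun _ => hτ, hasSum_unique _⟩

/-- For `t = 0` the convention `0⁻¹ = 0` is harmless, because a mixed state of trace zero vanishes.
-/
theorem IsMixed.inv_trace_mul_smul {σ : Op I} (hσ : IsMixed σ) {t : ℝ} (ht : trace σ = t) :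
    ((t : ℂ) * ((t⁻¹ : ℝ) : ℂ)) • σ = σ := by
  rcases eq_or_ne t 0 with rfl | h0
  · rw [hσ.eq_zero_of_trace (by simpa using ht), smul_zero]
  · rw [Complex.ofReal_inv, mul_inv_cancel₀ (by exact_mod_cast h0), one_smul]

/-- Two mixed states of the same trace are the marginals of a separable state, namely of
their normalized product. -/
theorem exists_product_coupling {σ : Op I} {τ : Op J} (hσ : IsMixed σ) (hτ : IsMixed τ) {t : ℝ}
    (hσt : trace σ = t) (hτt : trace τ = t) :
    IsSeparable (((t⁻¹ : ℝ) : ℂ) • tensorOp σ τ) ∧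
      traceSnd (((t⁻¹ : ℝ) : ℂ) • tensorOp σ τ) = σ ∧
      traceFst (((t⁻¹ : ℝ) : ℂ) • tensorOp σ τ) = τ := by
  have ht : 0 ≤ t := by
    have := hσ.re_trace_nonneg
    rwa [hσt, Complex.ofReal_re] at this
  have hσ' := hσ.smul (inv_nonneg.2 ht)
  -- Absorbing the normalization into the left factor exhibits the state as a single product of
  -- mixed states.
  rw [← tensorOp_smul_left]
  refine ⟨isSeparable_tensorOp hσ' hτ, ?_, ?_⟩
  · rw [traceSnd_tensorOp hσ' hτ, hτt, smul_smul, hσ.inv_trace_mul_smul hσt]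
  · rw [traceFst_tensorOp hσ' hτ, trace_smul, hσt, mul_comm, hτ.inv_trace_mul_smul hτt]

end Coupling

/-! ### The judgment and the limit of the final states of `y` -/

section Main

variable {V : Type*} {T : V → Type*} [∀ v, Nonempty (T v)] {x y : V} (hxy : x ≠ y)
  (ex : T x ≃ ℤ) (ey : T y ≃ Fin 2)

/-- With `t` the trace of `ρ`, the precondition has expectation `ε^n t`, while EQUAL has expectation
at least `a_n t` in the product coupling. -/
theorem rhl_zeno (n : ℕ) :
    Rhl (((zenoEps n ^ n : ℝ) : ℂ) • ContinuousLinearMap.id ℂ (Ell2 (Memory T × Memory T)))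
      (zenoRotate ex ey n) (zenoMeasure hxy ex ey n) (equalOn {y}) := by
  have hε : (0 : ℝ) ≤ zenoEps n ^ n := pow_nonneg (zenoEps_nonneg n) n
  refine ⟨ContinuousLinearMap.isPositive_id.smul_of_nonneg (by exact_mod_cast hε),
    isPositive_equalOn _, fun ρ hρ => ?_⟩
  have hρ := hρ.1
  obtain ⟨κ₁, hκ₁, ht₁, hc⟩ := denot_zenoRotate hxy ex ey hρ.traceSnd n
  obtain ⟨κ₂, hκ₂, ht₂, hd⟩ := denot_zenoMeasure hxy ex ey hρ.traceFst n
  rw [hρ.trace_traceSnd, ← hρ.ofReal_re_trace] at ht₁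
  rw [hρ.trace_traceFst, ← hρ.ofReal_re_trace] at ht₂
  rw [hc, hd]
  have ht0 := hρ.re_trace_nonneg
  set t := (trace ρ).re with ht
  obtain ⟨ha0, ha1⟩ := zenoProb_mem n n
  set a := zenoProb n n with had
  set φ := relabel ((assignOne T y).trans ey).symm (qubit (n * (Real.pi / (2 * n)))) with hφd
  set χ := relabel ((assignOne T y).trans ey).symm
    (qubit (n * (Real.pi / (2 * n)) + Real.pi / 2)) with hχd
  have hφ : ‖φ‖ = 1 := by rw [hφd, LinearIsometryEquiv.norm_map, norm_qubit]
  have hχ : ‖χ‖ = 1 := by rw [hχd, LinearIsometryEquiv.norm_map, norm_qubit]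
  have hσ := ((isMixed_proj φ).tensorOp hκ₁).relabelOp (split T {y}).symm
  have hτ := ((isMixed_mixture ha0 ha1 φ χ).tensorOp hκ₂).relabelOp (split T {y}).symm
  have hσt : trace (relabelOp (split T {y}).symm (tensorOp (proj φ) κ₁)) = (t : ℂ) := by
    rw [trace_relabelOp, (isMixed_proj φ).trace_tensorOp hκ₁, trace_proj, hφ, ht₁]
    simp
  have hτt : trace (relabelOp (split T {y}).symm (tensorOp (mixture a φ χ) κ₂)) = (t : ℂ) := by
    rw [trace_relabelOp, (isMixed_mixture ha0 ha1 φ χ).trace_tensorOp hκ₂,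
      trace_mixture ha0 ha1 hφ hχ, ht₂, one_mul]
  obtain ⟨hsep, hsnd, hfst⟩ := exists_product_coupling hσ hτ hσt hτt
  refine ⟨_, hsep, hsnd, hfst, ?_⟩
  have : Finite (Assign T {y}) := Finite.of_equiv _ ((assignOne T y).trans ey).symm
  rw [ContinuousLinearMap.smul_comp, ContinuousLinearMap.id_comp, trace_smul,
    ContinuousLinearMap.comp_smul, trace_smul, trace_equalOn_comp hκ₁ hκ₂, ht₁, ht₂,
    Complex.re_ofReal_mul, Complex.re_ofReal_mul, ← Complex.ofReal_mul, Complex.re_mul_ofReal]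
  have hE := le_re_trace_equalOp (χ := χ) ha1 hφ
  have hea := (zenoEps_pow_le_zenoProb n n).trans hE
  -- The factor `t⁻¹` normalizes the coupling and `t * t` comes from the two environments; at `t =
  -- 0` both sides vanish.
  have htt : ∀ r : ℝ, t⁻¹ * (r * (t * t)) = r * t := fun r => by
    rcases eq_or_ne t 0 with h0 | h0
    · simp [h0]
    · field_simp
  rw [htt]
  exact mul_le_mul_of_nonneg_right hea ht0

theorem norm_marginal_zeno_sub_le {ρ₁ ρ₂ : Op (Memory T)} (h₁ : IsMixed ρ₁) (h₂ : IsMixed ρ₂)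
    (ht₁ : trace ρ₁ = 1) (ht₂ : trace ρ₂ = 1) (n : ℕ) :
    ‖marginal {y} (denot (zenoRotate ex ey n) ρ₁) -
      marginal {y} (denot (zenoMeasure hxy ex ey n) ρ₂)‖ ≤ (1 - zenoEps n ^ n) * 2 := by
  obtain ⟨κ₁, hκ₁, hk₁, hc⟩ := denot_zenoRotate hxy ex ey h₁ n
  obtain ⟨κ₂, hκ₂, hk₂, hd⟩ := denot_zenoMeasure hxy ex ey h₂ n
  obtain ⟨ha0, ha1⟩ := zenoProb_mem n n
  rw [hc, hd, marginal_split_symm (isMixed_proj _) hκ₁,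
    marginal_split_symm (isMixed_mixture ha0 ha1 _ _) hκ₂, hk₁, hk₂, ht₁, ht₂, one_smul, one_smul]
  refine (norm_proj_sub_mixture_le ha1 ?_ ?_).trans ?_
  · rw [LinearIsometryEquiv.norm_map, norm_qubit]
  · rw [LinearIsometryEquiv.norm_map, norm_qubit]
  · linarith [zenoEps_pow_le_zenoProb n n]

theorem tendsto_norm_marginal_zeno_sub {ρ₁ ρ₂ : Op (Memory T)} (h₁ : IsMixed ρ₁)
    (h₂ : IsMixed ρ₂) (ht₁ : trace ρ₁ = 1) (ht₂ : trace ρ₂ = 1) :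
    Filter.Tendsto (fun n : ℕ => ‖marginal {y} (denot (zenoRotate ex ey n) ρ₁) -
      marginal {y} (denot (zenoMeasure hxy ex ey n) ρ₂)‖) Filter.atTop (nhds 0) := by
  refine squeeze_zero (fun n => norm_nonneg _)
    (norm_marginal_zeno_sub_le hxy ex ey h₁ h₂ ht₁ ht₂) ?_
  simpa using ((tendsto_const_nhds (x := (1 : ℝ))).sub tendsto_zenoEps_pow).mul_const 2

end Main

end QRHL

end

theorem mainTheorem3 {V : Type*} {T : V → Type*} [∀ v, Nonempty (T v)]
    {x y : V} (hxy : x ≠ y) (ex : T x ≃ ℤ) (ey : T y ≃ Fin 2) :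
    (∀ n : ℕ, 1 ≤ n →
      Rhl (((zenoEps n ^ n : ℝ) : ℂ) • ContinuousLinearMap.id ℂ (Ell2 (Memory T × Memory T)))
        (zenoRotate ex ey n) (zenoMeasure hxy ex ey n) (equalOn {y})) ∧
    Filter.Tendsto (fun n : ℕ => zenoEps n ^ n) Filter.atTop (nhds 1) ∧
    (∀ ρ₁ ρ₂ : Op (Memory T), IsMixed ρ₁ → IsMixed ρ₂ → trace ρ₁ = 1 → trace ρ₂ = 1 →
      Filter.Tendsto
        (fun n : ℕ => ‖marginal {y} (denot (zenoRotate ex ey n) ρ₁) -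
          marginal {y} (denot (zenoMeasure hxy ex ey n) ρ₂)‖)
        Filter.atTop (nhds 0)) :=
  ⟨fun n _ => rhl_zeno hxy ex ey n, tendsto_zenoEps_pow,
    fun _ _ h₁ h₂ ht₁ ht₂ => tendsto_norm_marginal_zeno_sub hxy ex ey h₁ h₂ ht₁ ht₂⟩
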